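/- A $\{\vee,0\}$-semilattice is a join-semilattice with a least element $0$; put $A^-=A\setminus\{0\}$. For a (nonempty) lattice $L$, $\operatorname{Con}_c L$ denotes the $\{\vee,0\}$-semilattice of compact congruences of $L$ (the compact elements of the complete lattice of all congruences of $L$). Let $\mathcal R$ (respectively $\mathcal R_0$, $\mathcal R_{0,1}$) be the class of all $\{\vee,0\}$-semilattices that are isomorphic to $\operatorname{Con}_c L$ for some lattice $L$ (respectively, some lattice $L$ with zero, some bounded lattice $L$). A lattice $L$ has permutable congruences if $\alpha\circ\beta=\beta\circ\alpha$ for all congruences $\alpha,\beta$ of $L$; let $\mathcal R^{c}$, $\mathcal R_0^{c}$, $\mathcal R_{0,1}^{c}$ be the classes defined as $\mathcal R$, $\mathcal R_0$, $\mathcal R_{0,1}$ but with the lattice $L$ required, in addition, to have permutable congruences. The tensor product $A\otimes B$ of $\{\vee,0\}$-semilattices $A$ and $B$ is the free $\{\vee,0\}$-semilattice generated by $A^-\times B^-$ subject to the relations $\langle a,b_0\rangle\vee\langle a,b_1\rangle=\langle a,b_0\vee b_1\rangle$ and $\langle a_0,b\rangle\vee\langle a_1,b\rangle=\langle a_0\vee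 a_1,b\rangle$, for $a,a_0,a_1\in A^-$ and $b,b_0,b_1\in B^-$. More generally, for a finite family $(S_i)_{i\in J}$ of $\{\vee,0\}$-semilattices, $\bigotimes_{i\in J}S_i$ is the $\{\vee,0\}$-semilattice generated by the symbols $\otimes_{i\in J}x_i$ (where $x_i\in S_i$ for all $i\in J$) subject to the relations saying that $\otimes_{i\in J}x_i$ is $0$ if some $x_i$ is $0$ and that it preserves binary joins in each variable separately (so $\bigotimes_{i\in\varnothing}S_i=\{0,1\}$). The iterated tensor product of a family $(S_i)_{i\in I}$ of bounded $\{\vee,0\}$-semilattices, with an arbitrary index set $I$, is the direct limit of the $\{\vee,0\}$-semilattices $\bigotimes_{i\in J}S_i$, where $J$ ranges over the finite subsets of $I$, with transition homomorphisms, for $J\subseteq K$, given by $\otimes_{i\in J}x_i\mapsto\otimes_{i\in K}x_i$, where $x_i=1_{S_i}$ for $i\in K\setminus J$. **Corollary.** 1. The classes $\mathcal R_0$ and $\mathcal R_{0,1}$ are closed under tensor product. 2. If $A\in\mathcal R_{0,1}$ and $B\in\mathcal R$, then $A\otimes B\in\mathcal R$. 3. The class $\mathcal R_{0,1}$ is closed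 under iterated tensor products. 4. The classes $\mathcal R_0^{c}$ and $\mathcal R_{0,1}^{c}$ are closed under tensor product. 5. If $A\in\mathcal R_{0,1}^{c}$ and $B\in\mathcal R^{c}$, then $A\otimes B\in\mathcal R^{c}$. 6. The class $\mathcal R_{0,1}^{c}$ is closed under iterated tensor products. -/

import Mathlib

universe u

noncomputable section

/-! ### Congruences of a lattice, compact congruences, permutable congruences -/

namespace LatticeCon

variable {L : Type u} [Lattice L]

theorem toSetoid_inj : Function.Injective (LatticeCon.toSetoid (α := L)) := by
  rintro ⟨s, _, _⟩ ⟨t, _, _⟩ h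
  cases h
  rfl

/-- Congruences are ordered by containment of relations. -/
instance : PartialOrder (LatticeCon L) :=
  PartialOrder.lift LatticeCon.toSetoid toSetoid_inj

theorem le_def {α β : LatticeCon L} : α ≤ β ↔ ∀ x y : L, α.r x y → β.r x y :=
  ⟨fun h _ _ hxy => h hxy, fun h x y hxy => h x y hxy⟩

/-- The infimum of a set of congruences is its intersection. -/
instance : InfSet (LatticeCon L) where
  sInf T :=
    { r := fun x y => ∀ α ∈ T, α.r x y
      iseqv :=
        ⟨fun x _ _ => Setoid.refl' _ x, fun h α hα => α.iseqv.symm (h α hα),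
          fun h k α hα => α.iseqv.trans (h α hα) (k α hα)⟩
      inf := fun h k α hα => α.inf (h α hα) (k α hα)
      sup := fun h k α hα => α.sup (h α hα) (k α hα) }

theorem isGLB_sInf (T : Set (LatticeCon L)) : IsGLB T (sInf T) :=
  ⟨fun _ hα => le_def.2 fun _ _ h => h _ hα,
    fun _ hβ => le_def.2 fun x y h _ hα => le_def.1 (hβ hα) x y h⟩

/-- The complete lattice `Con L` of all congruences of `L`. -/
instance : CompleteLattice (LatticeCon L) :=
  completeLatticeOfInf (LatticeCon L) isGLB_sInf

end LatticeCon

/-- `Conc L`: the `{∨,0}`-semilattice of compact congruences of `L`. -/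
def Conc (L : Type u) [Lattice L] : Type u :=
  {α : LatticeCon L // IsCompactElement α}

namespace Conc

variable (L : Type u) [Lattice L]

instance : SemilatticeSup (Conc L) :=
  Subtype.semilatticeSup fun {α β} hα hβ => by
    classical
    have h := CompleteLattice.isCompactElement_finsetSup (f := id)
      ({α, β} : Finset (LatticeCon L)) (by
        intro x hx
        rcases Finset.mem_insert.1 hx with rfl | hx
        · exact hα
        · rw [Finset.mem_singleton.1 hx]
          exact hβ)
    simpa using h

instance : OrderBot (Conc L) :=
  Subtype.orderBot (p := fun α : LatticeCon L => IsCompactElement α) (by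
    intro s _ hs _ _ _
    obtain ⟨x, hx⟩ := hs
    exact ⟨x, hx, bot_le⟩)

end Conc

/-- Any two congruences of `L` commute under composition of relations. -/
def HasPermutableCongruences (L : Type u) [Lattice L] : Prop :=
  ∀ α β : LatticeCon L, Relation.Comp α.r β.r = Relation.Comp β.r α.r

/-! ### Representable semilattices

An order isomorphism between `{∨,0}`-semilattices is the same as a semilattice isomorphism. -/

section Representable

variable (S : Type u) [SemilatticeSup S] [OrderBot S]

/-- The class `R`: `S ≅ Conc L` for some (nonempty) lattice `L`. -/
def IsRepresentable : Prop :=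
  ∃ (L : Type u) (_ : Lattice L), Nonempty L ∧ Nonempty (Conc L ≃o S)

/-- The class `R₀`: `S ≅ Conc L` for some lattice `L` with zero. -/
def IsZeroRepresentable : Prop :=
  ∃ (L : Type u) (_ : Lattice L) (_ : OrderBot L), Nonempty (Conc L ≃o S)

/-- The class `R₀,₁`: `S ≅ Conc L` for some bounded lattice `L`. -/
def IsZeroOneRepresentable : Prop :=
  ∃ (L : Type u) (_ : Lattice L) (_ : BoundedOrder L), Nonempty (Conc L ≃o S)

/-- The class `Rᶜ`: `S ≅ Conc L` for some (nonempty) lattice `L` with permutable congruences. -/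
def IsPermRepresentable : Prop :=
  ∃ (L : Type u) (_ : Lattice L),
    Nonempty L ∧ HasPermutableCongruences L ∧ Nonempty (Conc L ≃o S)

/-- The class `R₀ᶜ`: `S ≅ Conc L` for some lattice `L` with zero and permutable congruences. -/
def IsPermZeroRepresentable : Prop :=
  ∃ (L : Type u) (_ : Lattice L) (_ : OrderBot L),
    HasPermutableCongruences L ∧ Nonempty (Conc L ≃o S)

/-- The class `R₀,₁ᶜ`: `S ≅ Conc L` for some bounded lattice `L` with permutable congruences. -/
def IsPermZeroOneRepresentable : Prop :=
  ∃ (L : Type u) (_ : Lattice L) (_ : BoundedOrder L),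
    HasPermutableCongruences L ∧ Nonempty (Conc L ≃o S)

end Representable

/-! ### `{∨,0}`-semilattices presented by generators and relations -/

namespace PresentedSemilattice

variable {X : Type u}

open Classical in
/-- The least congruence, containing the relations `r`, of the free `{∨,0}`-semilattice
`(Finset X, ∪, ∅)` on `X`. -/
inductive Rel (r : Finset X → Finset X → Prop) : Finset X → Finset X → Prop
  | of {s t : Finset X} : r s t → Rel r s t
  | refl (s : Finset X) : Rel r s s
  | symm {s t : Finset X} : Rel r s t → Rel r t s
  | trans {s t v : Finset X} : Rel r s t → Rel r t v → Rel r s v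
  | union {s t s' t' : Finset X} : Rel r s t → Rel r s' t' → Rel r (s ∪ s') (t ∪ t')

/-- The congruence `Rel r` as a setoid. -/
def relSetoid (r : Finset X → Finset X → Prop) : Setoid (Finset X) :=
  ⟨Rel r, ⟨Rel.refl, Rel.symm, Rel.trans⟩⟩

end PresentedSemilattice

/-- The free `{∨,0}`-semilattice generated by `X` subject to the relations `r`, where `r s t`
means that the join of the generators in `s` is set equal to the join of those in `t`. -/
def PresentedSemilattice {X : Type u} (r : Finset X → Finset X → Prop) : Type u :=
  Quotient (PresentedSemilattice.relSetoid r)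

namespace PresentedSemilattice

variable {X : Type u} {r : Finset X → Finset X → Prop}

/-- The class of the join of a finite set of generators. -/
def mk (r : Finset X → Finset X → Prop) (s : Finset X) : PresentedSemilattice r :=
  Quotient.mk (relSetoid r) s

/-- The class of a generator. -/
def gen (r : Finset X → Finset X → Prop) (x : X) : PresentedSemilattice r :=
  mk r {x}

theorem mk_eq_mk {s t : Finset X} : mk r s = mk r t ↔ Rel r s t :=
  ⟨fun h => Quotient.exact h, fun h => Quotient.sound h⟩

theorem ind {p : PresentedSemilattice r → Prop} (h : ∀ s, p (mk r s)) (a) : p a :=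
  Quotient.ind h a

open Classical in
/-- The join induced by union; `a ≤ b` means `a ∨ b = b`. -/
instance : SemilatticeSup (PresentedSemilattice r) where
  sup := Quotient.map₂ (· ∪ ·) fun _ _ h _ _ h' => Rel.union h h'
  le a b := Quotient.map₂ (· ∪ ·) (fun _ _ h _ _ h' => Rel.union h h') a b = b
  le_refl a := by
    induction a using ind
    exact congrArg (mk r) (Finset.union_self _)
  le_trans a b c h h' := by
    induction a using ind with | h s => ?_
    induction b using ind with | h t => ?_
    induction c using ind with | h v => ?_
    change mk r (s ∪ t) = mk r t at h
    change mk r (t ∪ v) = mk r v at h'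
    change mk r (s ∪ v) = mk r v
    rw [mk_eq_mk] at h h' ⊢
    have h₁ := Rel.union (Rel.refl (r := r) s) h'.symm
    have h₂ := Rel.union h (Rel.refl (r := r) v)
    rw [Finset.union_assoc] at h₂
    exact h₁.trans (h₂.trans h')
  le_antisymm a b h h' := by
    induction a using ind with | h s => ?_
    induction b using ind with | h t => ?_
    change mk r (s ∪ t) = mk r t at h
    change mk r (t ∪ s) = mk r s at h'
    exact h'.symm.trans ((congrArg (mk r) (Finset.union_comm t s)).trans h)
  le_sup_left a b := by
    induction a using ind with | h s => ?_
    induction b using ind with | h t => ?_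
    change mk r (s ∪ (s ∪ t)) = mk r (s ∪ t)
    rw [← Finset.union_assoc, Finset.union_self]
  le_sup_right a b := by
    induction a using ind with | h s => ?_
    induction b using ind with | h t => ?_
    change mk r (t ∪ (s ∪ t)) = mk r (s ∪ t)
    rw [Finset.union_left_comm, Finset.union_self]
  sup_le a b c h h' := by
    induction a using ind with | h s => ?_
    induction b using ind with | h t => ?_
    induction c using ind with | h v => ?_
    change mk r (s ∪ v) = mk r v at h
    change mk r (t ∪ v) = mk r v at h'
    change mk r (s ∪ t ∪ v) = mk r v
    rw [mk_eq_mk] at h h' ⊢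
    rw [Finset.union_assoc]
    exact ((Rel.refl s).union h').trans h

open Classical in
theorem mk_sup_mk (s t : Finset X) : mk r s ⊔ mk r t = mk r (s ∪ t) := rfl

open Classical in
theorem mk_le_mk {s t : Finset X} : mk r s ≤ mk r t ↔ Rel r (s ∪ t) t := mk_eq_mk

instance : OrderBot (PresentedSemilattice r) where
  bot := mk r ∅
  bot_le a := by
    induction a using ind
    classical
    exact mk_le_mk.2 (by rw [Finset.empty_union]; exact Rel.refl _)

theorem mk_empty : mk r ∅ = ⊥ := rfl

theorem mk_eq_sup_gen (s : Finset X) : mk r s = s.sup (gen r) := by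
  classical
  induction s using Finset.induction with
  | empty => rfl
  | insert a s _ ih =>
    rw [Finset.sup_insert, ← ih, gen, mk_sup_mk]
    rfl

theorem sup_gen_eq {s t : Finset X} (h : r s t) : s.sup (gen r) = t.sup (gen r) := by
  rw [← mk_eq_sup_gen, ← mk_eq_sup_gen]
  exact mk_eq_mk.2 (Rel.of h)

theorem sup_eq_of_rel {S : Type*} [SemilatticeSup S] [OrderBot S] (f : X → S)
    (hf : ∀ s t, r s t → s.sup f = t.sup f) {s t : Finset X} (h : Rel r s t) :
    s.sup f = t.sup f := by
  classical
  induction h with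
  | of h => exact hf _ _ h
  | refl s => rfl
  | symm _ ih => exact ih.symm
  | trans _ _ ih ih' => exact ih.trans ih'
  | union _ _ ih ih' => rw [Finset.sup_union, Finset.sup_union, ih, ih']

/-- The universal property: a map on generators that respects the relations extends to a
`{∨,0}`-homomorphism. -/
def lift {S : Type*} [SemilatticeSup S] [OrderBot S] (f : X → S)
    (hf : ∀ s t, r s t → s.sup f = t.sup f) : SupBotHom (PresentedSemilattice r) S where
  toFun := Quotient.lift (fun s : Finset X => s.sup f) fun _ _ h => sup_eq_of_rel f hf h
  map_sup' a b := by
    classical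
    induction a using ind; induction b using ind
    exact Finset.sup_union
  map_bot' := Finset.sup_empty

theorem lift_mk {S : Type*} [SemilatticeSup S] [OrderBot S] (f : X → S)
    (hf : ∀ s t, r s t → s.sup f = t.sup f) (s : Finset X) :
    lift f hf (mk r s) = s.sup f := rfl

theorem lift_gen {S : Type*} [SemilatticeSup S] [OrderBot S] (f : X → S)
    (hf : ∀ s t, r s t → s.sup f = t.sup f) (x : X) : lift f hf (gen r x) = f x :=
  Finset.sup_singleton

theorem hom_ext {S : Type*} [SemilatticeSup S] [OrderBot S]
    {f g : SupBotHom (PresentedSemilattice r) S} (h : ∀ x, f (gen r x) = g (gen r x)) : f = g := by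
  ext a
  induction a using ind with
  | h s =>
    rw [mk_eq_sup_gen, map_finset_sup, map_finset_sup]
    exact Finset.sup_congr rfl fun x _ => h x

end PresentedSemilattice

/-! ### The tensor product of two `{∨,0}`-semilattices -/

section Tensor

variable (A B : Type u) [SemilatticeSup A] [OrderBot A] [SemilatticeSup B] [OrderBot B]

open Classical in
/-- The defining relations of `A ⊗ B` on the generators `A⁻ × B⁻`, where `A⁻ = A \ {0}`:
`⟨a, b₀⟩ ∨ ⟨a, b₁⟩ = ⟨a, b₀ ∨ b₁⟩` and `⟨a₀, b⟩ ∨ ⟨a₁, b⟩ = ⟨a₀ ∨ a₁, b⟩`. -/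
inductive SemilatticeTensor.Relations :
    Finset ({a : A // a ≠ ⊥} × {b : B // b ≠ ⊥}) →
      Finset ({a : A // a ≠ ⊥} × {b : B // b ≠ ⊥}) → Prop
  | right (a : {a : A // a ≠ ⊥}) (b₀ b₁ b : {b : B // b ≠ ⊥}) :
      (b : B) = (b₀ : B) ⊔ (b₁ : B) → Relations {(a, b₀), (a, b₁)} {(a, b)}
  | left (a₀ a₁ a : {a : A // a ≠ ⊥}) (b : {b : B // b ≠ ⊥}) :
      (a : A) = (a₀ : A) ⊔ (a₁ : A) → Relations {(a₀, b), (a₁, b)} {(a, b)}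

/-- The tensor product `A ⊗ B` of `{∨,0}`-semilattices. -/
abbrev SemilatticeTensor : Type u :=
  PresentedSemilattice (SemilatticeTensor.Relations A B)

end Tensor

/-! ### Finite and iterated tensor products -/

section FinTensor

variable {ι : Type u} (S : ι → Type u) [∀ i, SemilatticeSup (S i)] [∀ i, OrderBot (S i)]

open Classical in
/-- The defining relations of `⨂ i, S i` on the generators `⊗ᵢ xᵢ`, where `x ∈ ∏ i, S i`:
`⊗ᵢ xᵢ = 0` if some `xᵢ` is zero, and `⊗ᵢ xᵢ` preserves binary joins in each variable. -/
inductive SemilatticePiTensor.Relations : Finset (∀ i, S i) → Finset (∀ i, S i) → Prop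
  | zero (x : ∀ i, S i) (i : ι) : x i = ⊥ → Relations {x} ∅
  | sup (x y z : ∀ i, S i) (i : ι) : z i = x i ⊔ y i → (∀ j, j ≠ i → x j = z j ∧ y j = z j) →
      Relations {x, y} {z}

/-- The tensor product `⨂ i, S i` of a family of `{∨,0}`-semilattices indexed by `ι`
(used for finite `ι` only). For empty `ι` it is the two-element semilattice. -/
abbrev SemilatticePiTensor : Type u :=
  PresentedSemilattice (SemilatticePiTensor.Relations S)

/-- The pure tensor `⊗ᵢ xᵢ`. -/
def SemilatticePiTensor.tprod (x : ∀ i, S i) : SemilatticePiTensor S :=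
  PresentedSemilattice.gen (SemilatticePiTensor.Relations S) x

end FinTensor

namespace IteratedTensor

section Extend

variable {I : Type u} (S : I → Type u) [∀ i, LE (S i)] [∀ i, OrderTop (S i)]

open Classical in
/-- Extend a tuple indexed by `J` to one indexed by `K` by `xᵢ = 1` for `i ∈ K \ J`. -/
def extend (J K : Finset I) (x : ∀ i : J, S i) : ∀ i : K, S i :=
  fun i => if h : (i : I) ∈ J then x ⟨i, h⟩ else ⊤

variable {S} in
theorem extend_of_mem {J K : Finset I} (x : ∀ i : J, S i) (i : K) (h : (i : I) ∈ J) :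
    extend S J K x i = x ⟨i, h⟩ := dif_pos h

variable {S} in
theorem extend_of_notMem {J K : Finset I} (x : ∀ i : J, S i) (i : K) (h : (i : I) ∉ J) :
    extend S J K x i = ⊤ := dif_neg h

end Extend

variable {I : Type u} (S : I → Type u) [∀ i, SemilatticeSup (S i)] [∀ i, OrderBot (S i)]

/-- The finite tensor product `⨂ i ∈ J, S i`. -/
abbrev Stage (J : Finset I) : Type u := SemilatticePiTensor fun i : J => S i

variable [∀ i, OrderTop (S i)]

/-- The transition homomorphism `⊗_{i ∈ J} xᵢ ↦ ⊗_{i ∈ K} xᵢ`, for `J ⊆ K`,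
with `xᵢ = 1` for `i ∈ K \ J`. -/
def transition (J K : Finset I) (hJK : J ≤ K) : SupBotHom (Stage S J) (Stage S K) :=
  PresentedSemilattice.lift
    (fun x => SemilatticePiTensor.tprod (fun i : K => S i) (extend S J K x)) (by
      classical
      rintro _ _ (⟨x, i, hx⟩ | ⟨x, y, z, i, hz, h⟩)
      · have h := PresentedSemilattice.sup_gen_eq (SemilatticePiTensor.Relations.zero
          (S := fun i : K => S i) (extend S J K x) ⟨i, hJK i.2⟩
          (by rw [extend_of_mem x (⟨i, hJK i.2⟩ : K) i.2]; exact hx))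
        simpa [SemilatticePiTensor.tprod] using h
      · have h := PresentedSemilattice.sup_gen_eq (SemilatticePiTensor.Relations.sup
          (S := fun i : K => S i) (extend S J K x) (extend S J K y) (extend S J K z)
          ⟨i, hJK i.2⟩
          (by
            rw [extend_of_mem x (⟨i, hJK i.2⟩ : K) i.2, extend_of_mem y (⟨i, hJK i.2⟩ : K) i.2,
              extend_of_mem z (⟨i, hJK i.2⟩ : K) i.2]
            exact hz)
          (by
            intro j hj
            by_cases hjJ : (j : I) ∈ J
            · rw [extend_of_mem x _ hjJ, extend_of_mem y _ hjJ, extend_of_mem z _ hjJ]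
              refine h _ fun e => hj (Subtype.ext ?_)
              rw [← e]
            · rw [extend_of_notMem x _ hjJ, extend_of_notMem y _ hjJ,
                extend_of_notMem z _ hjJ]
              exact ⟨rfl, rfl⟩))
        simpa [SemilatticePiTensor.tprod] using h)

theorem transition_tprod (J K : Finset I) (hJK : J ≤ K) (x : ∀ i : J, S i) :
    transition S J K hJK (SemilatticePiTensor.tprod (fun i : J => S i) x) =
      SemilatticePiTensor.tprod (fun i : K => S i) (extend S J K x) :=
  PresentedSemilattice.lift_gen _ _ x

instance : DirectedSystem (Stage S) (transition S · · ·) where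
  map_self J a := by
    have h : transition S J J le_rfl = SupBotHom.id (Stage S J) :=
      PresentedSemilattice.hom_ext fun x => by
        refine (transition_tprod S J J le_rfl x).trans ?_
        have e : extend S J J x = x := funext fun i => extend_of_mem x i i.2
        rw [e]
        rfl
    rw [h]
    rfl
  map_map {L K J} hJK hKL a := by
    have h : (transition S K L hKL).comp (transition S J K hJK) =
        transition S J L (hJK.trans hKL) :=
      PresentedSemilattice.hom_ext fun x => by
        refine (congrArg (transition S K L hKL) (transition_tprod S J K hJK x)).trans
          ((transition_tprod S K L hKL _).trans
            (Eq.trans ?_ (transition_tprod S J L (hJK.trans hKL) x).symm))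
        congr 1
        funext i
        by_cases hK : (i : I) ∈ K
        · rw [extend_of_mem _ i hK]
          by_cases hJ : (i : I) ∈ J
          · rw [extend_of_mem x i hJ, extend_of_mem x ⟨i, hK⟩ hJ]
          · rw [extend_of_notMem x i hJ, extend_of_notMem x ⟨i, hK⟩ hJ]
        · rw [extend_of_notMem _ i hK, extend_of_notMem x i fun hJ => hK (hJK hJ)]
    rw [← h]
    rfl

instance : IsDirectedOrder (Finset I) := by
  classical
  exact SemilatticeSup.instIsDirectedOrder

end IteratedTensor

/-- The iterated tensor product of a family of bounded `{∨,0}`-semilattices: the direct limit of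
the finite tensor products `⨂ i ∈ J, S i` over the finite subsets `J` of the index set. -/
def IteratedTensor {I : Type u} (S : I → Type u) [∀ i, SemilatticeSup (S i)]
    [∀ i, OrderBot (S i)] [∀ i, OrderTop (S i)] : Type u :=
  DirectLimit (IteratedTensor.Stage S) (IteratedTensor.transition S)

namespace IteratedTensor

variable {I : Type u} (S : I → Type u) [∀ i, SemilatticeSup (S i)] [∀ i, OrderBot (S i)]
  [∀ i, OrderTop (S i)]

/-- The canonical map of a finite tensor product into the direct limit. -/
def incl (J : Finset I) (a : Stage S J) : IteratedTensor S :=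
  Quotient.mk (DirectLimit.setoid (transition S)) ⟨J, a⟩

/-- The join in the direct limit, computed in a common finite tensor product. -/
def join : IteratedTensor S → IteratedTensor S → IteratedTensor S :=
  DirectLimit.map₂ (transition S) (transition S) (transition S) (fun _ a b => a ⊔ b)
    fun J K h a b => map_sup (transition S J K h) a b

theorem join_incl (J : Finset I) (a b : Stage S J) :
    join S (incl S J a) (incl S J b) = incl S J (a ⊔ b) :=
  DirectLimit.map₂_def (transition S) (transition S) (transition S) (fun _ a b => a ⊔ b)
    (fun J K h a b => map_sup (transition S J K h) a b) J a b

theorem incl_transition (J K : Finset I) (h : J ≤ K) (a : Stage S J) :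
    incl S K (transition S J K h a) = incl S J a :=
  DirectLimit.mk_apply J K a h

theorem join_comm (a b : IteratedTensor S) : join S a b = join S b a := by
  obtain ⟨J, x, y, rfl, rfl⟩ := DirectLimit.exists_eq_mk₂ (transition S) a b
  exact (join_incl S J x y).trans
    ((congrArg (incl S J) (sup_comm x y)).trans (join_incl S J y x).symm)

theorem join_assoc (a b c : IteratedTensor S) :
    join S (join S a b) c = join S a (join S b c) := by
  obtain ⟨J, x, y, z, rfl, rfl, rfl⟩ := DirectLimit.exists_eq_mk₃ (transition S) a b c
  change join S (join S (incl S J x) (incl S J y)) (incl S J z) =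
    join S (incl S J x) (join S (incl S J y) (incl S J z))
  rw [join_incl, join_incl, join_incl, join_incl]
  exact congrArg (incl S J) (sup_assoc x y z)

theorem join_self (a : IteratedTensor S) : join S a a = a := by
  obtain ⟨J, x, rfl⟩ := DirectLimit.exists_eq_mk (transition S) a
  exact (join_incl S J x x).trans (congrArg (incl S J) (sup_idem x))

/-- `a ≤ b` means `a ∨ b = b`. -/
instance : SemilatticeSup (IteratedTensor S) where
  sup := join S
  le a b := join S a b = b
  le_refl a := join_self S a
  le_trans a b c h h' := by rw [← h', ← join_assoc, h]
  le_antisymm a b h h' := h'.symm.trans ((join_comm S b a).trans h)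
  le_sup_left a b := by rw [← join_assoc, join_self]
  le_sup_right a b := by rw [join_comm S a b, ← join_assoc, join_self]
  sup_le a b c h h' := by rw [join_assoc, h', h]

theorem incl_sup (J : Finset I) (a b : Stage S J) :
    incl S J (a ⊔ b) = incl S J a ⊔ incl S J b :=
  (join_incl S J a b).symm

instance : OrderBot (IteratedTensor S) where
  bot := incl S ∅ ⊥
  bot_le a := by
    obtain ⟨J, x, rfl⟩ := DirectLimit.exists_eq_mk (transition S) a
    have h : incl S ∅ ⊥ = incl S J ⊥ :=
      (incl_transition S ∅ J (Finset.empty_subset J) ⊥).symm.trans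
        (congrArg (incl S J) (map_bot (transition S ∅ J (Finset.empty_subset J))))
    change join S (incl S ∅ ⊥) (incl S J x) = incl S J x
    rw [h, join_incl]
    exact congrArg (incl S J) (bot_sup_eq x)

end IteratedTensor

end

noncomputable section

/-! ### Congruences of lattices -/

namespace LatticeCon

variable {L : Type u} [Lattice L]

theorem rel_inf {α β : LatticeCon L} {x y : L} : (α ⊓ β).r x y ↔ α.r x y ∧ β.r x y := by
  constructor
  · intro h
    exact ⟨le_def.1 inf_le_left x y h, le_def.1 inf_le_right x y h⟩
  · rintro ⟨h, k⟩
    have : sInf {α, β} ≤ α ⊓ β :=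
      le_inf (sInf_le (Set.mem_insert _ _)) (sInf_le (Set.mem_insert_of_mem _ rfl))
    refine le_def.1 this x y ?_
    rintro γ (rfl | rfl)
    · exact h
    · exact k

theorem rel_bot {x y : L} : (⊥ : LatticeCon L).r x y ↔ x = y := by
  constructor
  · intro h
    let ε : LatticeCon L :=
      { r := Eq
        iseqv := ⟨fun _ => rfl, fun h => h.symm, fun h k => h.trans k⟩
        inf := fun h k => by rw [h, k]
        sup := fun h k => by rw [h, k] }
    exact le_def.1 (bot_le : ⊥ ≤ ε) x y h
  · rintro rfl
    exact Setoid.refl' _ x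

theorem rel_top (x y : L) : (⊤ : LatticeCon L).r x y := by
  let τ : LatticeCon L :=
    { r := fun _ _ => True
      iseqv := ⟨fun _ => trivial, fun _ => trivial, fun _ _ => trivial⟩
      inf := fun _ _ => trivial
      sup := fun _ _ => trivial }
  exact le_def.1 (le_top : τ ≤ ⊤) x y trivial

theorem rel_refl (α : LatticeCon L) (x : L) : α.r x x := α.iseqv.refl x

theorem rel_symm {α : LatticeCon L} {x y : L} (h : α.r x y) : α.r y x := α.iseqv.symm h

theorem rel_trans {α : LatticeCon L} {x y z : L} (h : α.r x y) (k : α.r y z) : α.r x z :=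
  α.iseqv.trans h k

theorem rel_sup_right {α : LatticeCon L} {x y : L} (h : α.r x y) (z : L) :
    α.r (x ⊔ z) (y ⊔ z) := α.sup h (α.rel_refl z)

theorem rel_inf_right {α : LatticeCon L} {x y : L} (h : α.r x y) (z : L) :
    α.r (x ⊓ z) (y ⊓ z) := α.inf h (α.rel_refl z)

theorem rel_of_le_of_le {α : LatticeCon L} {x y z : L} (h : α.r x z) (hxy : x ≤ y) (hyz : y ≤ z) :
    α.r x y ∧ α.r y z := by
  have h₁ := rel_sup_right h y
  rw [sup_eq_right.2 hxy, sup_eq_left.2 hyz] at h₁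
  exact ⟨rel_trans h (rel_symm h₁), h₁⟩

/-- The relation obtained from a set of congruences by composing ascending steps. -/
def Chain (S : Set (LatticeCon L)) : L → L → Prop :=
  Relation.ReflTransGen fun a b => a ≤ b ∧ ∃ α ∈ S, α.r a b

theorem Chain.le {S : Set (LatticeCon L)} {x y : L} (h : Chain S x y) : x ≤ y := by
  induction h with
  | refl => exact le_rfl
  | tail _ h ih => exact ih.trans h.1

/-- The congruence of the pairs whose meet and join are linked by a chain. -/
def chainCon (S : Set (LatticeCon L)) : LatticeCon L :=
  haveI : Std.Refl fun x y : L => Chain S (x ⊓ y) (x ⊔ y) :=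
    ⟨fun x => by
      rw [inf_idem, sup_idem]
      exact Relation.ReflTransGen.refl⟩
  LatticeCon.mk' (fun x y => Chain S (x ⊓ y) (x ⊔ y))
    (fun x y => by
      rw [inf_eq_left.2 (inf_le_sup : x ⊓ y ≤ x ⊔ y), sup_eq_right.2 (inf_le_sup : x ⊓ y ≤ x ⊔ y)])
    (fun x y z hxy hyz h k => by
      rw [inf_eq_left.2 hxy, sup_eq_right.2 hxy] at h
      rw [inf_eq_left.2 hyz, sup_eq_right.2 hyz] at k
      rw [inf_eq_left.2 (hxy.trans hyz), sup_eq_right.2 (hxy.trans hyz)]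
      exact h.trans k)
    (fun x y t hxy h => by
      rw [inf_eq_left.2 hxy, sup_eq_right.2 hxy] at h
      rw [inf_eq_left.2 (inf_le_inf_right t hxy), sup_eq_right.2 (inf_le_inf_right t hxy),
        inf_eq_left.2 (sup_le_sup_right hxy t), sup_eq_right.2 (sup_le_sup_right hxy t)]
      constructor
      · exact Relation.ReflTransGen.lift (· ⊓ t) (fun a b ⟨hab, α, hα, hr⟩ =>
          ⟨inf_le_inf_right t hab, α, hα, rel_inf_right hr t⟩) _ _ h
      · exact Relation.ReflTransGen.lift (· ⊔ t) (fun a b ⟨hab, α, hα, hr⟩ =>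
          ⟨sup_le_sup_right hab t, α, hα, rel_sup_right hr t⟩) _ _ h)

theorem rel_sSup_iff {S : Set (LatticeCon L)} {x y : L} (hxy : x ≤ y) :
    (sSup S).r x y ↔ Chain S x y := by
  constructor
  · intro h
    have : sSup S ≤ chainCon S := sSup_le fun α hα => le_def.2 fun a b hab =>
      Relation.ReflTransGen.single ⟨inf_le_sup, α, hα, (r_inf_sup_iff α).2 hab⟩
    have h' : Chain S (x ⊓ y) (x ⊔ y) := le_def.1 this x y h
    rwa [inf_eq_left.2 hxy, sup_eq_right.2 hxy] at h'
  · intro h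
    induction h with
    | refl => exact rel_refl _ _
    | tail hc h ih =>
      obtain ⟨_, α, hα, hr⟩ := h
      exact rel_trans (ih (Chain.le hc)) (le_def.1 (le_sSup hα) _ _ hr)

theorem le_of_forall_le {α β : LatticeCon L} (h : ∀ x y, x ≤ y → α.r x y → β.r x y) : α ≤ β :=
  le_def.2 fun _ _ hxy =>
    (r_inf_sup_iff β).1 (h _ _ inf_le_sup ((r_inf_sup_iff α).2 hxy))

theorem inf_sup_le (α β γ : LatticeCon L) : α ⊓ (β ⊔ γ) ≤ (α ⊓ β) ⊔ (α ⊓ γ) := by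
  refine le_of_forall_le fun x y hxy h => ?_
  rw [rel_inf, ← sSup_pair, rel_sSup_iff hxy] at h
  obtain ⟨hα, h⟩ := h
  induction h using Relation.ReflTransGen.head_induction_on with
  | refl => exact rel_refl _ _
  | head hab hc ih =>
    obtain ⟨hle, δ, hδ, hr⟩ := hab
    obtain ⟨h₁, h₂⟩ := rel_of_le_of_le hα hle (Chain.le hc)
    refine rel_trans ?_ (ih (Chain.le hc) h₂)
    rcases hδ with rfl | rfl
    · exact le_def.1 le_sup_left _ _ (rel_inf.2 ⟨h₁, hr⟩)
    · exact le_def.1 le_sup_right _ _ (rel_inf.2 ⟨h₁, hr⟩)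

/-- `α.Below x y`: modulo the congruence `α`, the element `x` is below `y`. -/
def Below (α : LatticeCon L) (x y : L) : Prop := α.r (x ⊓ y) x

theorem Below.of_le (α : LatticeCon L) {x y : L} (h : x ≤ y) : α.Below x y := by
  unfold Below
  rw [inf_eq_left.2 h]

theorem Below.mono {α β : LatticeCon L} (h : α ≤ β) {x y : L} (hx : α.Below x y) : β.Below x y :=
  le_def.1 h _ _ hx

theorem Below.congr {α : LatticeCon L} {x x' y y' : L} (hx : α.r x x') (hy : α.r y y')
    (h : α.Below x y) : α.Below x' y' :=
  rel_trans (rel_symm (α.inf hx hy)) (rel_trans h hx)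

theorem Below.trans_le {α : LatticeCon L} {x y z : L} (h : α.Below x y) (hyz : y ≤ z) :
    α.Below x z := by
  unfold Below at h ⊢
  exact (rel_of_le_of_le h (inf_le_inf_left x hyz) inf_le_left).2

theorem Below.le_trans {α : LatticeCon L} {x y z : L} (hxy : x ≤ y) (h : α.Below y z) :
    α.Below x z := by
  have := rel_inf_right h x
  rwa [inf_right_comm, inf_eq_right.2 hxy] at this

theorem below_iff_sup {α : LatticeCon L} {x y : L} : α.Below x y ↔ α.r y (y ⊔ x) := by
  constructor
  · intro h
    have := rel_sup_right h y
    rwa [sup_eq_right.2 inf_le_right, sup_comm] at this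
  · intro h
    have := rel_inf_right h x
    rwa [inf_eq_right.2 (le_sup_right : x ≤ y ⊔ x), inf_comm] at this

theorem below_sInf {T : Set (LatticeCon L)} {x y : L} :
    (sInf T).Below x y ↔ ∀ α ∈ T, α.Below x y := Iff.rfl

theorem below_bot {x y : L} : (⊥ : LatticeCon L).Below x y ↔ x ≤ y :=
  rel_bot.trans inf_eq_left

theorem below_top (x y : L) : (⊤ : LatticeCon L).Below x y := rel_top _ _

theorem below_of_rel {α : LatticeCon L} {x y : L} (h : α.r x y) : α.Below x y :=
  Below.congr (α.rel_refl x) h (Below.of_le α le_rfl)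

theorem le_of_forall_below {α β : LatticeCon L} (h : ∀ x y, α.Below x y → β.Below x y) :
    α ≤ β := by
  refine le_of_forall_le fun x y hxy hr => ?_
  have := h y x (below_of_rel (rel_symm hr))
  unfold Below at this
  rwa [inf_eq_right.2 hxy] at this

/-- The least congruence that puts `x` below `y`. -/
def excess (x y : L) : LatticeCon L := sInf {α | α.Below x y}

theorem excess_le {x y : L} {α : LatticeCon L} : excess x y ≤ α ↔ α.Below x y :=
  ⟨fun h => Below.mono h (below_sInf.2 fun _ h => h), fun h => sInf_le h⟩

theorem below_excess (x y : L) : (excess x y).Below x y := excess_le.1 le_rfl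

theorem excess_eq_top {x y : L} (hx : IsTop x) (hy : IsBot y) : excess x y = ⊤ := by
  refine top_le_iff.1 (le_of_forall_below fun a b _ => ?_)
  exact Below.le_trans (hx a) (Below.trans_le (below_excess x y) (hy b))

theorem isCompactElement_excess (x y : L) : IsCompactElement (excess x y) := by
  rw [CompleteLattice.isCompactElement_iff_le_of_directed_sSup_le]
  intro S hne hdir h
  have h := excess_le.1 h
  unfold Below at h
  rw [rel_sSup_iff inf_le_left] at h
  have key : ∀ a b, Chain S a b → ∃ α ∈ S, α.r a b := by
    intro a b hc
    induction hc with
    | refl =>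
      obtain ⟨α, hα⟩ := hne
      exact ⟨α, hα, rel_refl _ _⟩
    | tail _ h ih =>
      obtain ⟨α, hα, h₁⟩ := ih
      obtain ⟨_, β, hβ, h₂⟩ := h
      obtain ⟨γ, hγ, h₃, h₄⟩ := hdir α hα β hβ
      exact ⟨γ, hγ, rel_trans (le_def.1 h₃ _ _ h₁) (le_def.1 h₄ _ _ h₂)⟩
  obtain ⟨α, hα, hr⟩ := key _ _ h
  exact ⟨α, hα, excess_le.2 hr⟩

theorem sSup_excess (α : LatticeCon L) :
    sSup ((fun z : L × L => excess z.1 z.2) '' {z | α.Below z.1 z.2}) = α := by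
  refine le_antisymm (sSup_le ?_) (le_of_forall_below fun x y h => ?_)
  · rintro _ ⟨z, hz, rfl⟩
    exact excess_le.2 hz
  · exact excess_le.1 (le_sSup ⟨(x, y), h, rfl⟩)

theorem exists_finset_excess {α : LatticeCon L} (h : IsCompactElement α) :
    ∃ F : Finset (L × L), α = F.sup fun z => excess z.1 z.2 := by
  classical
  obtain ⟨t, ht, hle⟩ :=
    (CompleteLattice.isCompactElement_iff_exists_le_sSup_of_le_sSup _ α).1 h _ (sSup_excess α).ge
  obtain ⟨F, hF, rfl⟩ := Finset.subset_set_image_iff.1 ht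
  refine ⟨F, le_antisymm ?_ (Finset.sup_le fun z hz => excess_le.2 (hF hz))⟩
  rwa [Finset.sup_image, Function.id_comp] at hle

theorem exists_compact_not_le {α β : LatticeCon L} (h : ¬ β ≤ α) :
    ∃ γ, IsCompactElement γ ∧ γ ≤ β ∧ ¬ γ ≤ α := by
  by_contra! hc
  refine h (le_of_forall_below fun x y hxy => ?_)
  exact excess_le.1 (hc _ (isCompactElement_excess x y) (excess_le.2 hxy))

/-- A compact element is avoided by some meet-prime congruence above any given congruence
that does not contain it. -/
theorem exists_prime {s α : LatticeCon L} (hs : IsCompactElement s) (h : ¬ s ≤ α) :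
    ∃ π, α ≤ π ∧ ¬ s ≤ π ∧ ∀ β γ, ¬ β ≤ π → ¬ γ ≤ π → ¬ β ⊓ γ ≤ π := by
  obtain ⟨π, hαπ, hπ⟩ := zorn_le_nonempty₀ {β : LatticeCon L | ¬ s ≤ β} (fun c hc hch y hy => by
    refine ⟨sSup c, fun hle => ?_, fun z hz => le_sSup hz⟩
    rw [CompleteLattice.isCompactElement_iff_le_of_directed_sSup_le] at hs
    obtain ⟨x, hx, hsx⟩ := hs c ⟨y, hy⟩ hch.directedOn hle
    exact hc hx hsx) α h
  refine ⟨π, hαπ, hπ.prop, fun β γ hβ hγ hle => hπ.prop ?_⟩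
  have step : ∀ δ, ¬ δ ≤ π → s ≤ π ⊔ δ := fun δ hδ => by
    by_contra hn
    exact hδ (le_sup_right.trans (hπ.le_of_ge hn le_sup_left))
  calc s ≤ (π ⊔ β) ⊓ (π ⊔ γ) := le_inf (step β hβ) (step γ hγ)
    _ ≤ ((π ⊔ β) ⊓ π) ⊔ ((π ⊔ β) ⊓ γ) := inf_sup_le _ _ _
    _ ≤ π := by
      refine sup_le inf_le_right ?_
      rw [inf_comm]
      refine (inf_sup_le _ _ _).trans (sup_le inf_le_right ?_)
      rwa [inf_comm]

end LatticeCon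

/-! ### The box product of a family of lattices -/

namespace BoxProduct

variable {I : Type u} (A : I → Type u) [∀ i, Lattice (A i)]

/-- The tuples that are almost everywhere the largest element. -/
def Rect : Type u := {p : ∀ i, A i // {i | ¬ IsTop (p i)}.Finite}

/-- The tuples that are almost everywhere the least element. -/
def Box : Type u := {q : ∀ i, A i // {i | ¬ IsBot (q i)}.Finite}

instance : Lattice (Rect A) :=
  Subtype.lattice
    (fun {x y} hx _ => hx.subset fun _ hi h => hi (h.mono le_sup_left))
    (fun {x y} hx hy => (hx.union hy).subset fun i hi => by
      by_contra h
      simp only [Set.mem_union, Set.mem_ofPred_eq, not_or, not_not] at h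
      exact hi fun b => le_inf (h.1 b) (h.2 b))

instance : Lattice (Box A) :=
  Subtype.lattice
    (fun {x y} hx hy => (hx.union hy).subset fun i hi => by
      by_contra h
      simp only [Set.mem_union, Set.mem_ofPred_eq, not_or, not_not] at h
      exact hi fun b => sup_le (h.1 b) (h.2 b))
    (fun {x y} hx _ => hx.subset fun _ hi h => hi (h.mono inf_le_left))

variable {A}

/-- The rectangle spanned by `p` is contained in the box spanned by `q`. -/
def Rel (p : Rect A) (q : Box A) : Prop := ∃ i, p.1 i ≤ q.1 i

theorem Rel.mono {p p' : Rect A} {q q' : Box A} (hp : p' ≤ p) (hq : q ≤ q') (h : Rel p q) :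
    Rel p' q' :=
  let ⟨i, hi⟩ := h
  ⟨i, (hp i).trans (hi.trans (hq i))⟩

/-- A rectangle contained in every box. -/
def Null (p : Rect A) : Prop := ∀ q, Rel p q

/-- A box containing every rectangle. -/
def Triv (q : Box A) : Prop := ∀ p, Rel p q

open Classical in
/-- Replace one coordinate of a rectangle. -/
def Rect.update (p : Rect A) (i : I) (x : A i) : Rect A :=
  ⟨Function.update p.1 i x, (p.2.union (Set.finite_singleton i)).subset fun j hj => by
    by_cases h : j = i
    · exact Or.inr h
    · left
      simpa [Function.update_of_ne h] using hj⟩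

open Classical in
/-- Replace one coordinate of a box. -/
def Box.update (q : Box A) (i : I) (x : A i) : Box A :=
  ⟨Function.update q.1 i x, (q.2.union (Set.finite_singleton i)).subset fun j hj => by
    by_cases h : j = i
    · exact Or.inr h
    · left
      simpa [Function.update_of_ne h] using hj⟩

@[simp] theorem Rect.update_self (p : Rect A) (i : I) (x : A i) : (p.update i x).1 i = x := by
  simp [Rect.update]

theorem Rect.update_of_ne (p : Rect A) {i j : I} (x : A i) (h : j ≠ i) :
    (p.update i x).1 j = p.1 j := by
  simp [Rect.update, h]

@[simp] theorem Box.update_self (q : Box A) (i : I) (x : A i) : (q.update i x).1 i = x := by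
  simp [Box.update]

theorem Box.update_of_ne (q : Box A) {i j : I} (x : A i) (h : j ≠ i) :
    (q.update i x).1 j = q.1 j := by
  simp [Box.update, h]

@[simp] theorem Rect.update_eq_self (p : Rect A) (i : I) : p.update i (p.1 i) = p :=
  Subtype.ext (by simp [Rect.update])

@[simp] theorem Box.update_eq_self (q : Box A) (i : I) : q.update i (q.1 i) = q :=
  Subtype.ext (by simp [Box.update])

theorem Rect.update_le_update (p : Rect A) (i : I) {x y : A i} (h : x ≤ y) :
    p.update i x ≤ p.update i y := fun j => by
  by_cases hj : j = i
  · subst hj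
    change (p.update j x).1 j ≤ (p.update j y).1 j
    simpa using h
  · change (p.update i x).1 j ≤ (p.update i y).1 j
    rw [p.update_of_ne _ hj, p.update_of_ne _ hj]

theorem Box.update_le_update (q : Box A) (i : I) {x y : A i} (h : x ≤ y) :
    q.update i x ≤ q.update i y := fun j => by
  by_cases hj : j = i
  · subst hj
    change (q.update j x).1 j ≤ (q.update j y).1 j
    simpa using h
  · change (q.update i x).1 j ≤ (q.update i y).1 j
    rw [q.update_of_ne _ hj, q.update_of_ne _ hj]

theorem Rect.update_le (p : Rect A) {i : I} {x : A i} (h : x ≤ p.1 i) : p.update i x ≤ p := by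
  simpa using p.update_le_update i h

theorem Box.le_update (q : Box A) {i : I} {x : A i} (h : q.1 i ≤ x) : q ≤ q.update i x := by
  simpa using q.update_le_update i h

theorem Rect.le_update {p r : Rect A} {i : I} {x : A i} (h : r ≤ p) (hx : r.1 i ≤ x) :
    r ≤ p.update i x := fun j => by
  by_cases hj : j = i
  · subst hj
    change r.1 j ≤ (p.update j x).1 j
    simpa using hx
  · change r.1 j ≤ (p.update i x).1 j
    rw [p.update_of_ne _ hj]
    exact h j

theorem Box.update_le {q r : Box A} {i : I} {x : A i} (h : q ≤ r) (hx : x ≤ r.1 i) :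
    q.update i x ≤ r := fun j => by
  by_cases hj : j = i
  · subst hj
    change (q.update j x).1 j ≤ r.1 j
    simpa using hx
  · change (q.update i x).1 j ≤ r.1 j
    rw [q.update_of_ne _ hj]
    exact h j

/-- The bi-ideal spanned by a rectangle. -/
abbrev pure (p : Rect A) : Concept (Rect A) (Box A) Rel := Concept.ofObject Rel p

/-- The bi-ideal of the rectangles contained in a box. -/
abbrev box (q : Box A) : Concept (Rect A) (Box A) Rel := Concept.ofAttribute Rel q

section Concept

variable {X Y : Concept (Rect A) (Box A) Rel} {p r : Rect A} {q : Box A}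

theorem mem_extent_iff : p ∈ X.extent ↔ ∀ q ∈ X.intent, Rel p q := by
  conv_lhs => rw [← X.lowerPolar_intent]
  rfl

theorem mem_intent_iff : q ∈ X.intent ↔ ∀ p ∈ X.extent, Rel p q := by
  conv_lhs => rw [← X.upperPolar_extent]
  rfl

theorem mem_extent_of_le (h : r ≤ p) (hp : p ∈ X.extent) : r ∈ X.extent :=
  mem_extent_iff.2 fun q hq => (mem_extent_iff.1 hp q hq).mono h le_rfl

theorem mem_extent_of_null (h : Null r) : r ∈ X.extent := mem_extent_iff.2 fun q _ => h q

theorem mem_intent_of_triv (h : Triv q) : q ∈ X.intent := mem_intent_iff.2 fun p _ => h p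

theorem pure_le_iff : pure p ≤ X ↔ p ∈ X.extent := by
  rw [Concept.ofObjects_le_iff, Set.singleton_subset_iff]

theorem le_box_iff : X ≤ box q ↔ q ∈ X.intent := by
  rw [Concept.le_ofAttributes_iff, Set.singleton_subset_iff]

theorem mem_intent_pure : q ∈ (pure p).intent ↔ Rel p q := by
  rw [Concept.intent_ofObjects]
  exact mem_upperPolar_singleton _

theorem mem_extent_box : p ∈ (box q).extent ↔ Rel p q := by
  rw [Concept.extent_ofAttributes]
  exact mem_lowerPolar_singleton _

theorem mem_extent_inf : p ∈ (X ⊓ Y).extent ↔ p ∈ X.extent ∧ p ∈ Y.extent := Iff.rfl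

theorem mem_intent_sup : q ∈ (X ⊔ Y).intent ↔ q ∈ X.intent ∧ q ∈ Y.intent := Iff.rfl

theorem le_iff : X ≤ Y ↔ ∀ p ∈ X.extent, p ∈ Y.extent := Concept.extent_subset_extent_iff.symm

theorem self_mem_extent_pure (p : Rect A) : p ∈ (pure p).extent :=
  mem_extent_iff.2 fun _ hq => mem_intent_pure.1 hq

theorem mem_extent_pure : r ∈ (pure p).extent ↔ Null r ∨ r ≤ p := by
  constructor
  · intro h
    by_contra! hc
    obtain ⟨hn, hle⟩ := hc
    unfold Null at hn
    push Not at hn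
    obtain ⟨q, hq⟩ := hn
    apply hle
    intro i
    by_contra hi
    obtain ⟨j, hj⟩ := mem_extent_iff.1 h (q.update i (p.1 i)) (mem_intent_pure.2 ⟨i, by simp⟩)
    by_cases hji : j = i
    · subst hji
      rw [Box.update_self] at hj
      exact hi hj
    · rw [Box.update_of_ne _ _ hji] at hj
      exact hq ⟨j, hj⟩
  · rintro (h | h)
    · exact mem_extent_of_null h
    · exact mem_extent_of_le h (self_mem_extent_pure p)

theorem null_of_isBot {i : I} (h : IsBot (p.1 i)) : Null p := fun _ => ⟨i, h _⟩

theorem triv_of_isTop {i : I} (h : IsTop (q.1 i)) : Triv q := fun _ => ⟨i, h _⟩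

end Concept

/-! #### Finitely generated sets of rectangles and of boxes -/

/-- A finite union of rectangles. -/
def FinLower (E : Set (Rect A)) : Prop :=
  ∃ F : Finset (Rect A), ∀ r, r ∈ E ↔ Null r ∨ ∃ p ∈ F, r ≤ p

/-- A finitely generated upper set of boxes. -/
def FinUpper (E : Set (Box A)) : Prop :=
  ∃ F : Finset (Box A), ∀ r, r ∈ E ↔ Triv r ∨ ∃ q ∈ F, q ≤ r

theorem FinLower.inter {E E' : Set (Rect A)} (h : FinLower E) (h' : FinLower E') :
    FinLower (E ∩ E') := by
  classical
  obtain ⟨F, hF⟩ := h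
  obtain ⟨F', hF'⟩ := h'
  refine ⟨Finset.image₂ (· ⊓ ·) F F', fun r => ?_⟩
  rw [Set.mem_inter_iff, hF, hF']
  constructor
  · rintro ⟨h | ⟨p, hp, hrp⟩, h' | ⟨p', hp', hrp'⟩⟩
    · exact Or.inl h
    · exact Or.inl h
    · exact Or.inl h'
    · exact Or.inr ⟨p ⊓ p', Finset.mem_image₂_of_mem hp hp', le_inf hrp hrp'⟩
  · rintro (h | ⟨x, hx, hr⟩)
    · exact ⟨Or.inl h, Or.inl h⟩
    · obtain ⟨p, hp, p', hp', rfl⟩ := Finset.mem_image₂.1 hx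
      exact ⟨Or.inr ⟨p, hp, hr.trans inf_le_left⟩, Or.inr ⟨p', hp', hr.trans inf_le_right⟩⟩

theorem FinUpper.inter {E E' : Set (Box A)} (h : FinUpper E) (h' : FinUpper E') :
    FinUpper (E ∩ E') := by
  classical
  obtain ⟨F, hF⟩ := h
  obtain ⟨F', hF'⟩ := h'
  refine ⟨Finset.image₂ (· ⊔ ·) F F', fun r => ?_⟩
  rw [Set.mem_inter_iff, hF, hF']
  constructor
  · rintro ⟨h | ⟨p, hp, hrp⟩, h' | ⟨p', hp', hrp'⟩⟩
    · exact Or.inl h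
    · exact Or.inl h
    · exact Or.inl h'
    · exact Or.inr ⟨p ⊔ p', Finset.mem_image₂_of_mem hp hp', sup_le hrp hrp'⟩
  · rintro (h | ⟨x, hx, hr⟩)
    · exact ⟨Or.inl h, Or.inl h⟩
    · obtain ⟨p, hp, p', hp', rfl⟩ := Finset.mem_image₂.1 hx
      exact ⟨Or.inr ⟨p, hp, le_sup_left.trans hr⟩, Or.inr ⟨p', hp', le_sup_right.trans hr⟩⟩

theorem FinLower.inter_box {E : Set (Rect A)} (h : FinLower E) (q : Box A) :
    FinLower (E ∩ {r | Rel r q}) := by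
  classical
  obtain ⟨F, hF⟩ := h
  refine ⟨Finset.image₂ (fun p i => p.update i (p.1 i ⊓ q.1 i)) F q.2.toFinset, fun r => ?_⟩
  rw [Set.mem_inter_iff, hF]
  constructor
  · rintro ⟨h | ⟨p, hp, hrp⟩, i, hi⟩
    · exact Or.inl h
    · by_cases hb : IsBot (q.1 i)
      · exact Or.inl (null_of_isBot (hb.mono hi))
      · refine Or.inr ⟨_, Finset.mem_image₂_of_mem hp (q.2.mem_toFinset.2 hb), ?_⟩
        exact Rect.le_update hrp (le_inf (hrp i) hi)
  · rintro (h | ⟨x, hx, hr⟩)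
    · exact ⟨Or.inl h, h q⟩
    · obtain ⟨p, hp, i, hi, rfl⟩ := Finset.mem_image₂.1 hx
      refine ⟨Or.inr ⟨p, hp, hr.trans (p.update_le inf_le_left)⟩, i, ?_⟩
      refine (hr i).trans ?_
      change (p.update i _).1 i ≤ _
      rw [Rect.update_self]
      exact inf_le_right

theorem FinUpper.inter_rect {E : Set (Box A)} (h : FinUpper E) (p : Rect A) :
    FinUpper (E ∩ {r | Rel p r}) := by
  classical
  obtain ⟨F, hF⟩ := h
  refine ⟨Finset.image₂ (fun q i => q.update i (q.1 i ⊔ p.1 i)) F p.2.toFinset, fun r => ?_⟩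
  rw [Set.mem_inter_iff, hF]
  constructor
  · rintro ⟨h | ⟨q, hq, hrq⟩, i, hi⟩
    · exact Or.inl h
    · by_cases hb : IsTop (p.1 i)
      · exact Or.inl (triv_of_isTop (hb.mono hi))
      · refine Or.inr ⟨_, Finset.mem_image₂_of_mem hq (p.2.mem_toFinset.2 hb), ?_⟩
        exact Box.update_le hrq (sup_le (hrq i) hi)
  · rintro (h | ⟨x, hx, hr⟩)
    · exact ⟨Or.inl h, h p⟩
    · obtain ⟨q, hq, i, hi, rfl⟩ := Finset.mem_image₂.1 hx
      refine ⟨Or.inr ⟨q, hq, (q.le_update le_sup_left).trans hr⟩, i, ?_⟩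
      refine le_trans ?_ (hr i)
      change _ ≤ (q.update i _).1 i
      rw [Box.update_self]
      exact le_sup_right

theorem FinLower.inter_finset {E : Set (Rect A)} (h : FinLower E) (Q : Finset (Box A)) :
    FinLower (E ∩ {r | ∀ q ∈ Q, Rel r q}) := by
  classical
  induction Q using Finset.induction with
  | empty => simpa using h
  | insert q Q _ ih =>
    convert ih.inter_box q using 1
    ext r
    simp only [Finset.forall_mem_insert, Set.mem_inter_iff, Set.mem_ofPred_eq]
    tauto

theorem FinUpper.inter_finset {E : Set (Box A)} (h : FinUpper E) (P : Finset (Rect A)) :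
    FinUpper (E ∩ {r | ∀ p ∈ P, Rel p r}) := by
  classical
  induction P using Finset.induction with
  | empty => simpa using h
  | insert q Q _ ih =>
    convert ih.inter_rect q using 1
    ext r
    simp only [Finset.forall_mem_insert, Set.mem_inter_iff, Set.mem_ofPred_eq]
    tauto

theorem FinLower.exists_bound {E : Set (Rect A)} (h : FinLower E) (p₀ : Rect A) :
    ∃ m, p₀ ≤ m ∧ ∀ r ∈ E, Null r ∨ r ≤ m := by
  classical
  obtain ⟨F, hF⟩ := h
  refine ⟨(insert p₀ F).sup' (Finset.insert_nonempty _ _) id,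
    Finset.le_sup' id (Finset.mem_insert_self _ _), fun r hr => ?_⟩
  rcases (hF r).1 hr with h | ⟨p, hp, hrp⟩
  · exact Or.inl h
  · exact Or.inr (hrp.trans (Finset.le_sup' id (Finset.mem_insert_of_mem hp)))

theorem FinUpper.exists_bound {E : Set (Box A)} (h : FinUpper E) (q₀ : Box A) :
    ∃ m, m ≤ q₀ ∧ ∀ r ∈ E, Triv r ∨ m ≤ r := by
  classical
  obtain ⟨F, hF⟩ := h
  refine ⟨(insert q₀ F).inf' (Finset.insert_nonempty _ _) id,
    Finset.inf'_le id (Finset.mem_insert_self _ _), fun r hr => ?_⟩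
  rcases (hF r).1 hr with h | ⟨p, hp, hrp⟩
  · exact Or.inl h
  · exact Or.inr (le_trans (Finset.inf'_le id (Finset.mem_insert_of_mem hp)) hrp)

section Concept

variable {X Y : Concept (Rect A) (Box A) Rel}

theorem finLower_of_finUpper (h : FinUpper X.intent) {m : Rect A}
    (hm : ∀ r ∈ X.extent, Null r ∨ r ≤ m) : FinLower X.extent := by
  obtain ⟨Q, hQ⟩ := h
  have h₁ : FinLower {r : Rect A | Null r ∨ r ≤ m} := ⟨{m}, by simp⟩
  convert h₁.inter_finset Q using 1
  ext r
  refine ⟨fun hr => ⟨hm r hr, fun q hq => mem_extent_iff.1 hr q ((hQ q).2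
    (Or.inr ⟨q, hq, le_rfl⟩))⟩, fun hr => mem_extent_iff.2 fun q hq => ?_⟩
  rcases (hQ q).1 hq with h | ⟨q', hq', hle⟩
  · exact h r
  · exact (hr.2 q' hq').mono le_rfl hle

theorem finUpper_of_finLower (h : FinLower X.extent) {m : Box A}
    (hm : ∀ r ∈ X.intent, Triv r ∨ m ≤ r) : FinUpper X.intent := by
  obtain ⟨P, hP⟩ := h
  have h₁ : FinUpper {r : Box A | Triv r ∨ m ≤ r} := ⟨{m}, by simp⟩
  convert h₁.inter_finset P using 1
  ext r
  refine ⟨fun hr => ⟨hm r hr, fun p hp => mem_intent_iff.1 hr p ((hP p).2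
    (Or.inr ⟨p, hp, le_rfl⟩))⟩, fun hr => mem_intent_iff.2 fun p hp => ?_⟩
  rcases (hP p).1 hp with h | ⟨p', hp', hle⟩
  · exact h r
  · exact (hr.2 p' hp').mono hle le_rfl

/-- Finitely generated both as a set of rectangles and as an intersection of boxes. -/
def IsFin (X : Concept (Rect A) (Box A) Rel) : Prop := FinLower X.extent ∧ FinUpper X.intent

theorem FinLower.of_isEmpty [IsEmpty (Rect A)] (E : Set (Rect A)) : FinLower E :=
  ⟨∅, fun r => isEmptyElim r⟩

theorem FinUpper.of_isEmpty [IsEmpty (Box A)] (E : Set (Box A)) : FinUpper E :=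
  ⟨∅, fun r => isEmptyElim r⟩

theorem extent_le_of_le_pure {m : Rect A} (h : X ≤ pure m) : ∀ r ∈ X.extent, Null r ∨ r ≤ m :=
  fun _ hr => mem_extent_pure.1 (le_iff.1 h _ hr)

theorem mem_intent_box {m q : Box A} : q ∈ (box m).intent ↔ Triv q ∨ m ≤ q := by
  constructor
  · intro h
    by_contra! hc
    obtain ⟨hn, hle⟩ := hc
    unfold Triv at hn
    push Not at hn
    obtain ⟨p, hp⟩ := hn
    apply hle
    intro i
    by_contra hi
    obtain ⟨j, hj⟩ := mem_intent_iff.1 h (p.update i (m.1 i)) (mem_extent_box.2 ⟨i, by simp⟩)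
    by_cases hji : j = i
    · subst hji
      rw [Rect.update_self] at hj
      exact hi hj
    · rw [Rect.update_of_ne _ _ hji] at hj
      exact hp ⟨j, hj⟩
  · rintro (h | h)
    · exact mem_intent_of_triv h
    · exact mem_intent_iff.2 fun p hp => (mem_extent_box.1 hp).mono le_rfl h

theorem IsFin.exists_le_pure (h : IsFin X) (p : Rect A) : ∃ m, p ≤ m ∧ X ≤ pure m := by
  obtain ⟨m, hpm, hm⟩ := h.1.exists_bound p
  exact ⟨m, hpm, le_iff.2 fun r hr => mem_extent_pure.2 (hm r hr)⟩

theorem IsFin.exists_box_le (h : IsFin X) (q : Box A) : ∃ m, m ≤ q ∧ box m ≤ X := by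
  obtain ⟨m, hpm, hm⟩ := h.2.exists_bound q
  exact ⟨m, hpm, Concept.intent_subset_intent_iff.1 fun r hr => mem_intent_box.2 (hm r hr)⟩

theorem pure_mono {p p' : Rect A} (h : p ≤ p') : pure p ≤ pure p' :=
  pure_le_iff.2 (mem_extent_pure.2 (Or.inr h))

theorem box_mono {p p' : Box A} (h : p ≤ p') : box p ≤ box p' :=
  le_box_iff.2 (mem_intent_box.2 (Or.inr h))

theorem IsFin.sup (hX : IsFin X) (hY : IsFin Y) : IsFin (X ⊔ Y) := by
  have hu : FinUpper (X ⊔ Y).intent := hX.2.inter hY.2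
  refine ⟨?_, hu⟩
  rcases isEmpty_or_nonempty (Rect A) with h | ⟨⟨p⟩⟩
  · exact FinLower.of_isEmpty _
  · obtain ⟨m, _, hm⟩ := hX.exists_le_pure p
    obtain ⟨m', hmm, hm'⟩ := hY.exists_le_pure m
    exact finLower_of_finUpper hu (extent_le_of_le_pure (sup_le (hm.trans (pure_mono hmm)) hm'))

theorem IsFin.inf (hX : IsFin X) (hY : IsFin Y) : IsFin (X ⊓ Y) := by
  have hl : FinLower (X ⊓ Y).extent := hX.1.inter hY.1
  refine ⟨hl, ?_⟩
  rcases isEmpty_or_nonempty (Box A) with h | ⟨⟨q⟩⟩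
  · exact FinUpper.of_isEmpty _
  · obtain ⟨m, _, hm⟩ := hX.exists_box_le q
    obtain ⟨m', hmm, hm'⟩ := hY.exists_box_le m
    exact finUpper_of_finLower hl (m := m') fun r hr => mem_intent_box.1
      (Concept.intent_subset_intent_iff.2 (le_inf ((box_mono hmm).trans hm) hm') hr)

theorem IsFin.sup_pure (hX : IsFin X) (p : Rect A) : IsFin (X ⊔ pure p) := by
  have hu : FinUpper (X ⊔ pure p).intent := by
    convert hX.2.inter_rect p using 1
    ext q
    rw [mem_intent_sup, mem_intent_pure]
    rfl
  obtain ⟨m, hpm, hm⟩ := hX.exists_le_pure p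
  exact ⟨finLower_of_finUpper hu (extent_le_of_le_pure (sup_le hm (pure_mono hpm))), hu⟩

theorem IsFin.inf_box (hX : IsFin X) (q : Box A) : IsFin (X ⊓ box q) := by
  have hl : FinLower (X ⊓ box q).extent := by
    convert hX.1.inter_box q using 1
    ext r
    rw [mem_extent_inf, mem_extent_box]
    rfl
  obtain ⟨m, hqm, hm⟩ := hX.exists_box_le q
  exact ⟨hl, finUpper_of_finLower hl (m := m) fun r hr => mem_intent_box.1
    (Concept.intent_subset_intent_iff.2 (le_inf hm (box_mono hqm)) hr)⟩

end Concept

end BoxProduct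

open BoxProduct

/-- The box product of a family of lattices. -/
def BoxProd {I : Type u} (A : I → Type u) [∀ i, Lattice (A i)] : Type u :=
  {X : Concept (Rect A) (Box A) Rel // IsFin X}

instance {I : Type u} (A : I → Type u) [∀ i, Lattice (A i)] : Lattice (BoxProd A) :=
  Subtype.lattice (fun _ _ => IsFin.sup) (fun _ _ => IsFin.inf)

namespace BoxProd

variable {I : Type u} {A : I → Type u} [∀ i, Lattice (A i)]

/-- The join of an element of the box product with a rectangle. -/
def addRect (X : BoxProd A) (p : Rect A) : BoxProd A := ⟨X.1 ⊔ pure p, X.2.sup_pure p⟩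

/-- The meet of an element of the box product with a box. -/
def meetBox (X : BoxProd A) (q : Box A) : BoxProd A := ⟨X.1 ⊓ box q, X.2.inf_box q⟩

theorem addRect_le {X Y : BoxProd A} {p : Rect A} :
    X.addRect p ≤ Y ↔ X ≤ Y ∧ p ∈ Y.1.extent := by
  rw [← pure_le_iff]
  exact sup_le_iff (α := Concept (Rect A) (Box A) Rel)

theorem le_meetBox {X Y : BoxProd A} {q : Box A} :
    Y ≤ X.meetBox q ↔ Y ≤ X ∧ q ∈ Y.1.intent := by
  rw [← le_box_iff]
  exact le_inf_iff (α := Concept (Rect A) (Box A) Rel)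

theorem le_addRect (X : BoxProd A) (p : Rect A) : X ≤ X.addRect p := (addRect_le.1 le_rfl).1

theorem mem_addRect (X : BoxProd A) (p : Rect A) : p ∈ (X.addRect p).1.extent :=
  (addRect_le.1 le_rfl).2

theorem meetBox_le (X : BoxProd A) (q : Box A) : X.meetBox q ≤ X := (le_meetBox.1 le_rfl).1

theorem mem_meetBox {X : BoxProd A} {q : Box A} {r : Rect A} :
    r ∈ (X.meetBox q).1.extent ↔ r ∈ X.1.extent ∧ Rel r q := by
  rw [← mem_extent_box]
  exact mem_extent_inf

theorem le_iff {X Y : BoxProd A} : X ≤ Y ↔ ∀ r ∈ X.1.extent, r ∈ Y.1.extent := BoxProduct.le_iff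

theorem mem_of_le {X Y : BoxProd A} (h : X ≤ Y) {r : Rect A} (hr : r ∈ X.1.extent) :
    r ∈ Y.1.extent := le_iff.1 h r hr

theorem mem_intent_of_le {X Y : BoxProd A} (h : X ≤ Y) {q : Box A} (hr : q ∈ Y.1.intent) :
    q ∈ X.1.intent := Concept.intent_subset_intent_iff.2 h hr

theorem mem_intent_addRect {X : BoxProd A} {p : Rect A} {q : Box A} :
    q ∈ (X.addRect p).1.intent ↔ q ∈ X.1.intent ∧ Rel p q := by
  rw [← mem_intent_pure]
  exact mem_intent_sup

theorem addRect_mono {X Y : BoxProd A} {p p' : Rect A} (h : X ≤ Y) (hp : p ≤ p') :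
    X.addRect p ≤ Y.addRect p' :=
  addRect_le.2 ⟨h.trans (le_addRect _ _), mem_extent_of_le hp (mem_addRect _ _)⟩

theorem addRect_of_mem {X : BoxProd A} {p : Rect A} (h : p ∈ X.1.extent) : X.addRect p = X :=
  le_antisymm (addRect_le.2 ⟨le_rfl, h⟩) (le_addRect _ _)

theorem meetBox_of_mem {X : BoxProd A} {q : Box A} (h : q ∈ X.1.intent) : X.meetBox q = X :=
  le_antisymm (meetBox_le _ _) (le_meetBox.2 ⟨le_rfl, h⟩)

theorem meetBox_mono {X Y : BoxProd A} {q q' : Box A} (h : X ≤ Y) (hq : q ≤ q') :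
    X.meetBox q ≤ Y.meetBox q' :=
  le_iff.2 fun r hr => by
    rw [mem_meetBox] at hr ⊢
    exact ⟨mem_of_le h hr.1, hr.2.mono le_rfl hq⟩

theorem inf_meetBox {X Y : BoxProd A} (h : Y ≤ X) (q : Box A) : X.meetBox q ⊓ Y = Y.meetBox q := by
  refine le_antisymm (le_iff.2 fun r hr => ?_)
    (le_inf (meetBox_mono h le_rfl) (meetBox_le _ _))
  exact mem_meetBox.2 ⟨mem_of_le inf_le_right hr, (mem_meetBox.1 (mem_of_le inf_le_left hr)).2⟩

theorem sup_addRect {X Y : BoxProd A} (h : X ≤ Y) (p : Rect A) : X.addRect p ⊔ Y = Y.addRect p :=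
  le_antisymm (sup_le (addRect_mono h le_rfl) (le_addRect _ _))
    (addRect_le.2 ⟨le_sup_right, mem_of_le le_sup_left (mem_addRect _ _)⟩)

/-- The join of `z` and the rectangle `p` is their union. -/
def Fits (z : BoxProd A) (p : Rect A) : Prop :=
  ∀ r ∈ (z.addRect p).1.extent, r ∈ z.1.extent ∨ r ≤ p

variable (A) in
/-- There are arbitrarily small elements that fit any given rectangles. -/
class HasAnchors : Prop where
  exists_fits : ∀ (P : Finset (Rect A)) (Q : Finset (Box A)),
    ∃ z : BoxProd A, (∀ q ∈ Q, q ∈ z.1.intent) ∧ ∀ p ∈ P, Fits z p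

theorem exists_anchor [HasAnchors A] (X : BoxProd A) (P : Finset (Rect A)) (Q : Finset (Box A)) :
    ∃ z : BoxProd A, z ≤ X ∧ (∀ q ∈ Q, q ∈ z.1.intent) ∧ ∀ p ∈ P, Fits z p := by
  classical
  obtain ⟨Q', hQ'⟩ := X.2.2
  obtain ⟨z, hz, hP⟩ := HasAnchors.exists_fits P (Q ∪ Q')
  refine ⟨z, Concept.intent_subset_intent_iff.1 fun q hq => ?_,
    fun q hq => hz q (Finset.mem_union_left _ hq), hP⟩
  rcases (hQ' q).1 hq with h | ⟨q', hq', hle⟩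
  · exact mem_intent_of_triv h
  · exact mem_intent_iff.2 fun p hp =>
      (mem_intent_iff.1 (hz q' (Finset.mem_union_right _ hq')) p hp).mono le_rfl hle

/-- The congruence `θ` puts the rectangle `p` below the box `q`. -/
def Models (θ : LatticeCon (BoxProd A)) (p : Rect A) (q : Box A) : Prop :=
  ∀ z : BoxProd A, q ∈ z.1.intent → θ.r ((z.addRect p).meetBox q) (z.addRect p)

theorem Models.mono {θ φ : LatticeCon (BoxProd A)} (h : θ ≤ φ) {p : Rect A} {q : Box A}
    (hm : Models θ p q) : Models φ p q :=
  fun z hq => LatticeCon.le_def.1 h _ _ (hm z hq)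

theorem models_sInf {T : Set (LatticeCon (BoxProd A))} {p : Rect A} {q : Box A} :
    Models (sInf T) p q ↔ ∀ θ ∈ T, Models θ p q :=
  ⟨fun h θ hθ z hq => h z hq θ hθ, fun h z hq θ hθ => h θ hθ z hq⟩

theorem Models.of_rel (θ : LatticeCon (BoxProd A)) {p : Rect A} {q : Box A} (h : Rel p q) :
    Models θ p q := fun z hq => by
  rw [meetBox_of_mem (mem_intent_addRect.2 ⟨hq, h⟩)]

theorem mem_extent_update_sup {X : Concept (Rect A) (Box A) Rel} {p : Rect A} {i : I} {x y : A i}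
    (hx : p.update i x ∈ X.extent) (hy : p.update i y ∈ X.extent) :
    p.update i (x ⊔ y) ∈ X.extent :=
  mem_extent_iff.2 fun q hq => by
    obtain ⟨j, hj⟩ := mem_extent_iff.1 hx q hq
    obtain ⟨k, hk⟩ := mem_extent_iff.1 hy q hq
    by_cases hji : j = i
    · by_cases hki : k = i
      · subst hji
        subst hki
        rw [Rect.update_self] at hj hk
        exact ⟨k, by rw [Rect.update_self]; exact sup_le hj hk⟩
      · rw [Rect.update_of_ne _ _ hki] at hk
        exact ⟨k, by rwa [Rect.update_of_ne _ _ hki]⟩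
    · rw [Rect.update_of_ne _ _ hji] at hj
      exact ⟨j, by rwa [Rect.update_of_ne _ _ hji]⟩

theorem rel_addRect_of_models {θ : LatticeCon (BoxProd A)} {Y : BoxProd A} {p : Rect A}
    (h : ∀ q ∈ Y.1.intent, Models θ p q) : θ.r Y (Y.addRect p) := by
  classical
  obtain ⟨Q, hQ⟩ := Y.2.2
  have key : ∀ Q' ⊆ Q, ∃ V ≤ Y.addRect p, θ.r V (Y.addRect p) ∧ ∀ q ∈ Q', q ∈ V.1.intent := by
    intro Q'
    induction Q' using Finset.induction with
    | empty => exact fun _ => ⟨Y.addRect p, le_rfl, θ.rel_refl _, by simp⟩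
    | insert q Q' _ ih =>
      intro hsub
      rw [Finset.insert_subset_iff] at hsub
      obtain ⟨V, hV, hr, hVQ⟩ := ih hsub.2
      have hqY : q ∈ Y.1.intent := (hQ q).2 (Or.inr ⟨q, hsub.1, le_rfl⟩)
      refine ⟨V.meetBox q, (meetBox_le _ _).trans hV, ?_, fun q' hq' => ?_⟩
      · have := LatticeCon.rel_inf_right (h q hqY Y hqY) V
        rw [inf_meetBox hV, inf_eq_right.2 hV] at this
        exact LatticeCon.rel_trans this hr
      · rcases Finset.mem_insert.1 hq' with rfl | hq'
        · exact (le_meetBox.1 le_rfl).2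
        · exact mem_intent_of_le (meetBox_le _ _) (hVQ q' hq')
  obtain ⟨V, hV, hr, hVQ⟩ := key Q subset_rfl
  have hVY : V ≤ Y := Concept.intent_subset_intent_iff.1 fun q hq => by
    rcases (hQ q).1 hq with h | ⟨q', hq', hle⟩
    · exact mem_intent_of_triv h
    · exact mem_intent_iff.2 fun p hp => (mem_intent_iff.1 (hVQ q' hq') p hp).mono le_rfl hle
  have := LatticeCon.rel_sup_right hr Y
  rwa [sup_eq_right.2 hVY, sup_eq_left.2 (le_addRect Y p)] at this

/-- An element whose rectangles are all absorbed modulo a congruence is itself absorbed. -/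
theorem rel_sup_of_forall_addRect {θ : LatticeCon (BoxProd A)} {X Y : BoxProd A}
    (h : ∀ p ∈ X.1.extent, θ.r Y (Y.addRect p)) : θ.r Y (Y ⊔ X) := by
  classical
  obtain ⟨F, hF⟩ := X.2.1
  have key : ∀ F' ⊆ F, ∃ V, Y ≤ V ∧ θ.r Y V ∧ ∀ p ∈ F', p ∈ V.1.extent := by
    intro F'
    induction F' using Finset.induction with
    | empty => exact fun _ => ⟨Y, le_rfl, θ.rel_refl _, by simp⟩
    | insert p F' _ ih =>
      intro hsub
      rw [Finset.insert_subset_iff] at hsub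
      obtain ⟨V, hV, hr, hVF⟩ := ih hsub.2
      refine ⟨V.addRect p, hV.trans (le_addRect _ _), ?_, fun p' hp' => ?_⟩
      · have := LatticeCon.rel_sup_right (h p ((hF p).2 (Or.inr ⟨p, hsub.1, le_rfl⟩))) V
        rw [sup_addRect hV, sup_eq_right.2 hV] at this
        exact LatticeCon.rel_trans hr this
      · rcases Finset.mem_insert.1 hp' with rfl | hp'
        · exact mem_addRect _ _
        · exact mem_of_le (le_addRect _ _) (hVF p' hp')
  obtain ⟨V, hV, hr, hVF⟩ := key F subset_rfl
  have hXV : X ≤ V := le_iff.2 fun r hr => by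
    rcases (hF r).1 hr with h | ⟨p, hp, hle⟩
    · exact mem_extent_of_null h
    · exact mem_extent_of_le hle (hVF p hp)
  exact (LatticeCon.rel_of_le_of_le hr le_sup_left (sup_le hV hXV)).1

variable [HasAnchors A]

theorem Models.of_exists {θ : LatticeCon (BoxProd A)} {p : Rect A} {q : Box A} {z : BoxProd A}
    (h : θ.r ((z.addRect p).meetBox q) (z.addRect p)) : Models θ p q := by
  intro z' hq'
  obtain ⟨y, hy, -, -⟩ := exists_anchor (z ⊓ z') {p} {q}
  have h₁ := LatticeCon.rel_inf_right h (y.addRect p)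
  rw [inf_meetBox (addRect_mono (hy.trans inf_le_left) le_rfl),
    inf_eq_right.2 (addRect_mono (hy.trans inf_le_left) le_rfl)] at h₁
  have h₂ := LatticeCon.rel_sup_right h₁ z'
  rw [sup_addRect (hy.trans inf_le_right)] at h₂
  exact (LatticeCon.rel_of_le_of_le h₂
    (sup_le (meetBox_mono (addRect_mono (hy.trans inf_le_right) le_rfl) le_rfl)
      (le_meetBox.2 ⟨le_addRect _ _, hq'⟩)) (meetBox_le _ _)).2

theorem Models.congr_box {θ : LatticeCon (BoxProd A)} {p : Rect A} {q q' : Box A}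
    (h : ∀ r ≤ p, Rel r q → Rel r q') (hm : Models θ p q) : Models θ p q' := by
  classical
  obtain ⟨z, hz, hfit⟩ := HasAnchors.exists_fits {p} {q, q'}
  refine Models.of_exists (z := z) ((LatticeCon.rel_of_le_of_le (hm z (hz q (by simp)))
    (le_iff.2 fun r hr => ?_) (meetBox_le _ _)).2)
  rw [mem_meetBox] at hr ⊢
  refine ⟨hr.1, ?_⟩
  rcases hfit p (by simp) r hr.1 with hrz | hrp
  · exact mem_extent_iff.1 hrz q' (hz q' (by simp))
  · exact h r hrp hr.2

theorem models_update_inf {θ : LatticeCon (BoxProd A)} {p : Rect A} {q : Box A} {i : I} {x y : A i} :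
    Models θ (p.update i x) (q.update i (x ⊓ y)) ↔ Models θ (p.update i x) (q.update i y) := by
  refine ⟨fun h => h.congr_box fun r _ hr => hr.mono le_rfl (q.update_le_update i inf_le_right),
    fun h => h.congr_box fun r hrp hr => ?_⟩
  obtain ⟨j, hj⟩ := hr
  refine ⟨j, ?_⟩
  by_cases hji : j = i
  · subst hji
    have := hrp j
    change r.1 j ≤ (p.update j x).1 j at this
    simp only [Rect.update_self, Box.update_self] at this hj ⊢
    exact le_inf this hj
  · rw [Box.update_of_ne _ _ hji] at hj ⊢
    exact hj

theorem models_update_trans {θ : LatticeCon (BoxProd A)} {p : Rect A} {q : Box A} {i : I}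
    {x y z : A i} (hxy : x ≤ y) (hyz : y ≤ z) (h₁ : Models θ (p.update i y) (q.update i x))
    (h₂ : Models θ (p.update i z) (q.update i y)) :
    Models θ (p.update i z) (q.update i x) := by
  classical
  obtain ⟨w, hw, hfit⟩ := HasAnchors.exists_fits {p.update i z} {q.update i x, q.update i y}
  have h₁ := LatticeCon.rel_sup_right (h₁ w (hw _ (by simp)))
    ((w.addRect (p.update i z)).meetBox (q.update i x))
  have h₂ := h₂ w (hw _ (by simp))
  have hle := addRect_mono (le_refl w) (p.update_le_update i hyz)
  rw [sup_eq_right.2 (meetBox_mono hle le_rfl)] at h₁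
  refine Models.of_exists (z := w) (LatticeCon.rel_trans h₁
    (LatticeCon.rel_of_le_of_le h₂ (le_iff.2 fun r hr => ?_) (sup_le hle (meetBox_le _ _))).2)
  rw [mem_meetBox] at hr
  rcases hfit _ (by simp) r hr.1 with hrw | hrp
  · exact mem_of_le ((le_addRect _ _).trans le_sup_left) hrw
  · obtain ⟨j, hj⟩ := hr.2
    by_cases hji : j = i
    · subst hji
      refine mem_of_le le_sup_left (mem_extent_of_le ?_ (mem_addRect _ _))
      have hry : r ≤ (p.update j z).update j y := Rect.le_update hrp (by simpa using hj)
      refine hry.trans (le_of_eq ?_)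
      exact Subtype.ext (by simp [Rect.update])
    · refine mem_of_le le_sup_right (mem_meetBox.2 ⟨hr.1, j, ?_⟩)
      rw [Box.update_of_ne _ _ hji] at hj ⊢
      exact hj

theorem models_update_inf_right {θ : LatticeCon (BoxProd A)} {p : Rect A} {q : Box A} {i : I}
    {x y : A i} (h : Models θ (p.update i y) (q.update i x)) (t : A i) :
    Models θ (p.update i (y ⊓ t)) (q.update i (x ⊓ t)) := by
  classical
  obtain ⟨w, hw, hfit⟩ := HasAnchors.exists_fits {p.update i (y ⊓ t)} {q.update i x}
  have hle := addRect_mono (le_refl w) (p.update_le_update i (inf_le_left : y ⊓ t ≤ y))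
  have h₁ := LatticeCon.rel_inf_right (h w (hw _ (by simp))) (w.addRect (p.update i (y ⊓ t)))
  rw [inf_meetBox hle, inf_eq_right.2 hle] at h₁
  rw [← models_update_inf, show y ⊓ t ⊓ (x ⊓ t) = y ⊓ t ⊓ x by
    rw [inf_inf_inf_comm, inf_idem, inf_right_comm], models_update_inf]
  exact Models.of_exists h₁

theorem models_update_sup_right {θ : LatticeCon (BoxProd A)} {p : Rect A} {q : Box A} {i : I}
    {x y : A i} (h : Models θ (p.update i y) (q.update i x)) (t : A i) :
    Models θ (p.update i (y ⊔ t)) (q.update i (x ⊔ t)) := by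
  classical
  obtain ⟨w, hw, -⟩ := HasAnchors.exists_fits {p.update i (y ⊔ t)}
    {q.update i x, q.update i (x ⊔ t)}
  have hle := addRect_mono (le_refl w) (p.update_le_update i (le_sup_left : y ≤ y ⊔ t))
  have h₁ := LatticeCon.rel_sup_right (h w (hw _ (by simp)))
    ((w.addRect (p.update i (y ⊔ t))).meetBox (q.update i (x ⊔ t)))
  rw [sup_eq_right.2 (meetBox_mono hle (q.update_le_update i le_sup_left))] at h₁
  have heq : w.addRect (p.update i y) ⊔
      (w.addRect (p.update i (y ⊔ t))).meetBox (q.update i (x ⊔ t)) =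
        w.addRect (p.update i (y ⊔ t)) :=
    le_antisymm (sup_le hle (meetBox_le _ _)) (addRect_le.2
      ⟨(le_addRect _ _).trans le_sup_left, mem_extent_update_sup
        (mem_of_le le_sup_left (mem_addRect _ _)) (mem_of_le le_sup_right (mem_meetBox.2
          ⟨mem_extent_of_le (p.update_le_update i le_sup_right) (mem_addRect _ _), i, by simp⟩))⟩)
  rw [heq] at h₁
  exact Models.of_exists h₁

/-- The congruence induced on a factor by a congruence of the box product. -/
def coordCon (θ : LatticeCon (BoxProd A)) (p : Rect A) (q : Box A) (i : I) : LatticeCon (A i) :=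
  haveI : Std.Refl fun x y : A i => Models θ (p.update i (x ⊔ y)) (q.update i (x ⊓ y)) :=
    ⟨fun x => Models.of_rel θ ⟨i, by simp⟩⟩
  LatticeCon.mk' (fun x y => Models θ (p.update i (x ⊔ y)) (q.update i (x ⊓ y)))
    (fun x y => by
      rw [inf_eq_left.2 (inf_le_sup : x ⊓ y ≤ x ⊔ y), sup_eq_right.2 (inf_le_sup : x ⊓ y ≤ x ⊔ y)])
    (fun x y z hxy hyz h k => by
      rw [inf_eq_left.2 hxy, sup_eq_right.2 hxy] at h
      rw [inf_eq_left.2 hyz, sup_eq_right.2 hyz] at k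
      rw [inf_eq_left.2 (hxy.trans hyz), sup_eq_right.2 (hxy.trans hyz)]
      exact models_update_trans hxy hyz h k)
    (fun x y t hxy h => by
      rw [inf_eq_left.2 hxy, sup_eq_right.2 hxy] at h
      rw [inf_eq_left.2 (inf_le_inf_right t hxy), sup_eq_right.2 (inf_le_inf_right t hxy),
        inf_eq_left.2 (sup_le_sup_right hxy t), sup_eq_right.2 (sup_le_sup_right hxy t)]
      exact ⟨models_update_inf_right h t, models_update_sup_right h t⟩)

theorem below_coordCon {θ : LatticeCon (BoxProd A)} {p : Rect A} {q : Box A} {i : I} {x y : A i} :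
    (coordCon θ p q i).Below x y ↔ Models θ (p.update i x) (q.update i y) := by
  change Models θ (p.update i (x ⊓ y ⊔ x)) (q.update i (x ⊓ y ⊓ x)) ↔ _
  rw [sup_eq_right.2 (inf_le_left : x ⊓ y ≤ x), inf_eq_left.2 (inf_le_left : x ⊓ y ≤ x),
    models_update_inf]

theorem models_of_rel_addRect {θ : LatticeCon (BoxProd A)} {Y : BoxProd A} {p : Rect A} {q : Box A}
    (h : θ.r Y (Y.addRect p)) (hq : q ∈ Y.1.intent) : Models θ p q := by
  have h₁ : θ.r ((Y.addRect p).meetBox q) (Y.addRect p) :=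
    (LatticeCon.rel_of_le_of_le h (le_meetBox.2 ⟨le_addRect _ _, hq⟩) (meetBox_le _ _)).2
  exact Models.of_exists h₁

theorem below_iff_models {θ : LatticeCon (BoxProd A)} {X Y : BoxProd A} :
    θ.Below X Y ↔ ∀ p ∈ X.1.extent, ∀ q ∈ Y.1.intent, Models θ p q := by
  rw [LatticeCon.below_iff_sup]
  refine ⟨fun h p hp q hq => models_of_rel_addRect (LatticeCon.rel_of_le_of_le h (le_addRect _ _)
    (addRect_le.2 ⟨le_sup_left, mem_of_le le_sup_right hp⟩)).1 hq,
    fun h => rel_sup_of_forall_addRect fun p hp => rel_addRect_of_models (h p hp)⟩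

theorem le_of_models {θ φ : LatticeCon (BoxProd A)}
    (h : ∀ p q, Models θ p q → Models φ p q) : θ ≤ φ :=
  LatticeCon.le_of_forall_below fun _ _ hXY =>
    below_iff_models.2 fun p hp q hq => h p q (below_iff_models.1 hXY p hp q hq)

end BoxProd

namespace BoxProd

variable {I : Type u} {A : I → Type u} [∀ i, Lattice (A i)]

/-! #### Tensors of congruences -/

/-- The least congruence of the box product that puts the rectangle `p` below the box `q` as soon
as each `s i` puts `p i` below `q i`. -/
def tens (s : ∀ i, LatticeCon (A i)) : LatticeCon (BoxProd A) :=
  sInf {θ | ∀ p q, (∀ i, (s i).Below (p.1 i) (q.1 i)) → Models θ p q}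

theorem tens_le_iff {s : ∀ i, LatticeCon (A i)} {θ : LatticeCon (BoxProd A)} :
    tens s ≤ θ ↔ ∀ p q, (∀ i, (s i).Below (p.1 i) (q.1 i)) → Models θ p q :=
  ⟨fun h p q hpq => (models_sInf.2 fun _ hφ => hφ p q hpq : Models (tens s) p q).mono h,
    fun h => sInf_le h⟩

theorem models_tens {s : ∀ i, LatticeCon (A i)} {p : Rect A} {q : Box A}
    (h : ∀ i, (s i).Below (p.1 i) (q.1 i)) : Models (tens s) p q := tens_le_iff.1 le_rfl p q h

theorem tens_mono {s t : ∀ i, LatticeCon (A i)} (h : ∀ i, s i ≤ t i) : tens s ≤ tens t :=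
  tens_le_iff.2 fun _ _ hpq => models_tens fun i => (hpq i).mono (h i)

theorem tens_eq_bot {s : ∀ i, LatticeCon (A i)} {i : I} (h : s i = ⊥) : tens s = ⊥ :=
  le_bot_iff.1 (tens_le_iff.2 fun _ _ hpq =>
    Models.of_rel _ ⟨i, LatticeCon.below_bot.1 (h ▸ hpq i)⟩)

/-- The tuple of the least congruences that put the entries of `p` below those of `q`. -/
def excessTuple (p : Rect A) (q : Box A) (i : I) : LatticeCon (A i) :=
  LatticeCon.excess (p.1 i) (q.1 i)

theorem finite_excessTuple_ne_top (p : Rect A) (q : Box A) : {i | excessTuple p q i ≠ ⊤}.Finite :=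
  (p.2.union q.2).subset fun i hi => by
    by_contra h
    simp only [Set.mem_union, Set.mem_ofPred_eq, not_or, not_not] at h
    exact hi (LatticeCon.excess_eq_top h.1 h.2)

variable [HasAnchors A]

theorem tens_sup {s t w : ∀ i, LatticeCon (A i)} {i : I} (hi : w i = s i ⊔ t i)
    (hne : ∀ j, j ≠ i → s j = w j ∧ t j = w j) : tens w = tens s ⊔ tens t := by
  apply le_antisymm
  · refine tens_le_iff.2 fun p q hpq => ?_
    have key : ∀ v : ∀ i, LatticeCon (A i), (∀ j, j ≠ i → v j = w j) →
        tens v ≤ tens s ⊔ tens t → v i ≤ coordCon (tens s ⊔ tens t) p q i := by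
      intro v hv hle
      refine LatticeCon.le_of_forall_below fun x y hxy => below_coordCon.2 ?_
      refine tens_le_iff.1 hle _ _ fun j => ?_
      by_cases hj : j = i
      · subst hj
        simpa using hxy
      · rw [Rect.update_of_ne _ _ hj, Box.update_of_ne _ _ hj, hv j hj]
        exact hpq j
    have h := sup_le (key s (fun j hj => (hne j hj).1) le_sup_left)
      (key t (fun j hj => (hne j hj).2) le_sup_right)
    rw [← hi] at h
    simpa using below_coordCon.1 ((hpq i).mono h)
  · refine sup_le (tens_mono fun j => ?_) (tens_mono fun j => ?_)
    all_goals
      by_cases hj : j = i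
      · subst hj
        rw [hi]
        first | exact le_sup_left | exact le_sup_right
      · first | exact (hne j hj).1.le | exact (hne j hj).2.le

theorem tens_excessTuple_le {p : Rect A} {q : Box A} {θ : LatticeCon (BoxProd A)} :
    tens (excessTuple p q) ≤ θ ↔ Models θ p q := by
  classical
  refine ⟨fun h => tens_le_iff.1 h p q fun i => LatticeCon.below_excess _ _, fun h => ?_⟩
  have key : ∀ (J : Finset I) (p' : Rect A) (q' : Box A),
      (∀ i, (excessTuple p q i).Below (p'.1 i) (q'.1 i)) →
      (∀ i ∉ J, p'.1 i = p.1 i ∧ q'.1 i = q.1 i) → Models θ p' q' := by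
    intro J
    induction J using Finset.induction with
    | empty =>
      intro p' q' _ hJ
      rwa [show p' = p from Subtype.ext (funext fun i => (hJ i (by simp)).1),
        show q' = q from Subtype.ext (funext fun i => (hJ i (by simp)).2)]
    | insert i J _ ih =>
      intro p' q' hpq hJ
      have h₁ := ih (p'.update i (p.1 i)) (q'.update i (q.1 i))
        (fun j => by
          by_cases hj : j = i
          · subst hj
            simpa [excessTuple] using LatticeCon.below_excess _ _
          · rw [Rect.update_of_ne _ _ hj, Box.update_of_ne _ _ hj]
            exact hpq j)
        (fun j hj => by
          by_cases hji : j = i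
          · subst hji
            simp
          · rw [Rect.update_of_ne _ _ hji, Box.update_of_ne _ _ hji]
            exact hJ j (by simp [hji, hj]))
      have h₂ := (hpq i).mono (LatticeCon.excess_le.2 (below_coordCon.2 h₁))
      simpa using below_coordCon.1 h₂
  refine tens_le_iff.2 fun p' q' hpq => key
    (p.2.toFinset ∪ p'.2.toFinset ∪ q.2.toFinset ∪ q'.2.toFinset) p' q' hpq fun i hi => ?_
  simp only [Finset.mem_union, Set.Finite.mem_toFinset, Set.mem_ofPred_eq, not_or, not_not] at hi
  obtain ⟨⟨⟨h₁, h₂⟩, h₃⟩, h₄⟩ := hi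
  exact ⟨le_antisymm (h₁ _) (h₂ _), le_antisymm (h₄ _) (h₃ _)⟩

theorem isCompactElement_tens_excessTuple (p : Rect A) (q : Box A) :
    IsCompactElement (tens (excessTuple p q)) := by
  obtain ⟨z, hz, -⟩ := HasAnchors.exists_fits {p} {q}
  have : tens (excessTuple p q) =
      LatticeCon.excess (z.addRect p) ((z.addRect p).meetBox q) := by
    refine eq_of_forall_ge_iff fun θ => ?_
    rw [tens_excessTuple_le, LatticeCon.excess_le, LatticeCon.Below,
      inf_eq_right.2 (meetBox_le _ _)]
    exact ⟨fun h => h z (hz q (by simp)), Models.of_exists⟩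
  rw [this]
  exact LatticeCon.isCompactElement_excess _ _

theorem isCompactElement_tens {s : ∀ i, LatticeCon (A i)} (hs : ∀ i, IsCompactElement (s i))
    (hfin : {i | s i ≠ ⊤}.Finite) (p₀ : Rect A) (q₀ : Box A) : IsCompactElement (tens s) := by
  classical
  have key : ∀ (J : Finset I) (s : ∀ i, LatticeCon (A i)) (p : Rect A) (q : Box A),
      (∀ i, IsCompactElement (s i)) → (∀ i ∉ J, s i = excessTuple p q i) →
      IsCompactElement (tens s) := by
    intro J
    induction J using Finset.induction with
    | empty =>
      intro s p q _ h
      rw [show s = excessTuple p q from funext fun i => h i (by simp)]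
      exact isCompactElement_tens_excessTuple p q
    | insert i J _ ih =>
      intro s p q hs h
      obtain ⟨F, hF⟩ := LatticeCon.exists_finset_excess (hs i)
      have step : ∀ F : Finset (A i × A i), IsCompactElement
          (tens (Function.update s i (F.sup fun z => LatticeCon.excess z.1 z.2))) := by
        intro F
        induction F using Finset.induction with
        | empty =>
          rw [tens_eq_bot (i := i) (by simp)]
          exact CompleteLattice.isCompactElement_finsetSup (f := id) ∅ (by simp)
        | insert z F _ ihF =>
          rw [Finset.sup_insert, tens_sup (i := i)
            (s := Function.update s i (LatticeCon.excess z.1 z.2))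
            (t := Function.update s i (F.sup fun z => LatticeCon.excess z.1 z.2))
            (by simp) (fun j hj => by simp [hj])]
          have h₁ := ih (Function.update s i (LatticeCon.excess z.1 z.2)) (p.update i z.1)
            (q.update i z.2)
            (fun j => by
              by_cases hj : j = i
              · subst hj
                simpa using LatticeCon.isCompactElement_excess _ _
              · rw [Function.update_of_ne hj]
                exact hs j)
            (fun j hj => by
              by_cases hji : j = i
              · subst hji
                simp [excessTuple]
              · rw [Function.update_of_ne hji, h j (by simp [hji, hj]), excessTuple, excessTuple,
                  Rect.update_of_ne _ _ hji, Box.update_of_ne _ _ hji])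
          have := CompleteLattice.isCompactElement_finsetSup (f := id)
            ({tens (Function.update s i (LatticeCon.excess z.1 z.2)),
              tens (Function.update s i (F.sup fun z => LatticeCon.excess z.1 z.2))} :
              Finset (LatticeCon (BoxProd A))) (by
              intro x hx
              rcases Finset.mem_insert.1 hx with rfl | hx
              · exact h₁
              · rw [Finset.mem_singleton.1 hx]
                exact ihF)
          simpa using this
      have := step F
      rwa [← hF, Function.update_eq_self] at this
  refine key (hfin.toFinset ∪ (finite_excessTuple_ne_top p₀ q₀).toFinset) s p₀ q₀ hs fun i hi => ?_
  simp only [Finset.mem_union, Set.Finite.mem_toFinset, Set.mem_ofPred_eq, not_or, not_not] at hi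
  rw [hi.1, hi.2]

end BoxProd

namespace BoxProd

variable {I : Type u} {A : I → Type u} [∀ i, Lattice (A i)]

/-! #### The congruence of the box product given by congruences of the factors -/

/-- Modulo the congruences `α i`, the rectangle `p` is contained in the box `q`. -/
def RelMod (α : ∀ i, LatticeCon (A i)) (p : Rect A) (q : Box A) : Prop :=
  ∃ i, (α i).Below (p.1 i) (q.1 i)

theorem RelMod.of_rel (α : ∀ i, LatticeCon (A i)) {p : Rect A} {q : Box A} (h : Rel p q) :
    RelMod α p q :=
  let ⟨i, hi⟩ := h
  ⟨i, LatticeCon.Below.of_le _ hi⟩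

theorem RelMod.congr {α : ∀ i, LatticeCon (A i)} {p p' : Rect A} {q q' : Box A}
    (hp : ∀ i, (α i).r (p.1 i) (p'.1 i)) (hq : ∀ i, (α i).r (q.1 i) (q'.1 i))
    (h : RelMod α p q) : RelMod α p' q' :=
  let ⟨i, hi⟩ := h
  ⟨i, hi.congr (hp i) (hq i)⟩

theorem exists_rect_of_relMod {α : ∀ i, LatticeCon (A i)} {p : Rect A} (Q : Finset (Box A))
    (h : ∀ q ∈ Q, RelMod α p q) :
    ∃ p' ≤ p, (∀ i, (α i).r (p'.1 i) (p.1 i)) ∧ ∀ q ∈ Q, Rel p' q := by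
  classical
  induction Q using Finset.induction with
  | empty => exact ⟨p, le_rfl, fun i => (α i).rel_refl _, by simp⟩
  | insert q Q _ ih =>
    rw [Finset.forall_mem_insert] at h
    obtain ⟨p', hle, hr, hQ⟩ := ih h.2
    obtain ⟨i, hi⟩ := h.1
    have hle' : p'.update i (p'.1 i ⊓ q.1 i) ≤ p' := p'.update_le inf_le_left
    refine ⟨p'.update i (p'.1 i ⊓ q.1 i), hle'.trans hle, fun j => ?_, ?_⟩
    · by_cases hj : j = i
      · subst hj
        rw [Rect.update_self]
        exact LatticeCon.rel_trans (LatticeCon.Below.le_trans (hle j) hi) (hr j)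
      · rw [Rect.update_of_ne _ _ hj]
        exact hr j
    · rw [Finset.forall_mem_insert]
      exact ⟨⟨i, by simp⟩, fun q' hq' => (hQ q' hq').mono hle' le_rfl⟩

theorem exists_box_of_relMod {α : ∀ i, LatticeCon (A i)} {q : Box A} (P : Finset (Rect A))
    (h : ∀ p ∈ P, RelMod α p q) :
    ∃ q', q ≤ q' ∧ (∀ i, (α i).r (q'.1 i) (q.1 i)) ∧ ∀ p ∈ P, Rel p q' := by
  classical
  induction P using Finset.induction with
  | empty => exact ⟨q, le_rfl, fun i => (α i).rel_refl _, by simp⟩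
  | insert p P _ ih =>
    rw [Finset.forall_mem_insert] at h
    obtain ⟨q', hle, hr, hP⟩ := ih h.2
    obtain ⟨i, hi⟩ := h.1
    have hle' : q' ≤ q'.update i (q'.1 i ⊔ p.1 i) := q'.le_update le_sup_left
    refine ⟨q'.update i (q'.1 i ⊔ p.1 i), hle.trans hle', fun j => ?_, ?_⟩
    · by_cases hj : j = i
      · subst hj
        rw [Box.update_self]
        exact LatticeCon.rel_trans (LatticeCon.rel_symm (LatticeCon.below_iff_sup.1
          (hi.trans_le (hle j)))) (hr j)
      · rw [Box.update_of_ne _ _ hj]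
        exact hr j
    · rw [Finset.forall_mem_insert]
      exact ⟨⟨i, by simp⟩, fun q' hq' => (hP q' hq').mono le_rfl hle'⟩

/-- The rectangles contained in `X` modulo the congruences `α i`. -/
def extMod (α : ∀ i, LatticeCon (A i)) (X : BoxProd A) : Set (Rect A) :=
  {p | ∀ q ∈ X.1.intent, RelMod α p q}

/-- The boxes containing `X` modulo the congruences `α i`. -/
def intMod (α : ∀ i, LatticeCon (A i)) (X : BoxProd A) : Set (Box A) :=
  {q | ∀ p ∈ X.1.extent, RelMod α p q}

variable {α : ∀ i, LatticeCon (A i)} {X Y : BoxProd A}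

theorem mem_extMod_of_mem {p : Rect A} (h : p ∈ X.1.extent) : p ∈ extMod α X :=
  fun q hq => RelMod.of_rel α (mem_extent_iff.1 h q hq)

theorem exists_mem_of_mem_extMod {p : Rect A} (h : p ∈ extMod α X) :
    ∃ p' ≤ p, p' ∈ X.1.extent ∧ ∀ i, (α i).r (p'.1 i) (p.1 i) := by
  obtain ⟨Q, hQ⟩ := X.2.2
  obtain ⟨p', hle, hr, hp'⟩ := exists_rect_of_relMod Q
    fun q hq => h q ((hQ q).2 (Or.inr ⟨q, hq, le_rfl⟩))
  refine ⟨p', hle, mem_extent_iff.2 fun q hq => ?_, hr⟩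
  rcases (hQ q).1 hq with hq | ⟨q', hq', hle'⟩
  · exact hq p'
  · exact (hp' q' hq').mono le_rfl hle'

theorem exists_mem_of_mem_intMod {q : Box A} (hX : q ∈ intMod α X) (hY : q ∈ intMod α Y) :
    ∃ q', q' ∈ (X ⊔ Y).1.intent ∧ ∀ i, (α i).r (q'.1 i) (q.1 i) := by
  classical
  obtain ⟨F, hF⟩ := X.2.1
  obtain ⟨G, hG⟩ := Y.2.1
  obtain ⟨q', hle, hr, hq'⟩ := exists_box_of_relMod (F ∪ G) fun p hp => by
    rcases Finset.mem_union.1 hp with hp | hp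
    · exact hX p ((hF p).2 (Or.inr ⟨p, hp, le_rfl⟩))
    · exact hY p ((hG p).2 (Or.inr ⟨p, hp, le_rfl⟩))
  refine ⟨q', mem_intent_sup.2 ⟨mem_intent_iff.2 fun p hp => ?_,
    mem_intent_iff.2 fun p hp => ?_⟩, hr⟩
  · rcases (hF p).1 hp with hp | ⟨p', hp', hle'⟩
    · exact hp q'
    · exact (hq' p' (Finset.mem_union_left _ hp')).mono hle' le_rfl
  · rcases (hG p).1 hp with hp | ⟨p', hp', hle'⟩
    · exact hp q'
    · exact (hq' p' (Finset.mem_union_right _ hp')).mono hle' le_rfl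

theorem mem_intMod_iff {q : Box A} : q ∈ intMod α X ↔ ∀ p ∈ extMod α X, RelMod α p q := by
  refine ⟨fun h p hp => ?_, fun h p hp => h p (mem_extMod_of_mem hp)⟩
  obtain ⟨p', _, hp', hr⟩ := exists_mem_of_mem_extMod hp
  exact (h p' hp').congr hr fun i => (α i).rel_refl _

theorem mem_extMod_iff {p : Rect A} : p ∈ extMod α X ↔ ∀ q ∈ intMod α X, RelMod α p q :=
  ⟨fun h _ hq => mem_intMod_iff.1 hq p h, fun h q hq =>
    h q fun r hr => RelMod.of_rel α (mem_intent_iff.1 hq r hr)⟩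

theorem extMod_inf : extMod α (X ⊓ Y) = extMod α X ∩ extMod α Y := by
  ext p
  constructor
  · intro h
    exact ⟨fun q hq => h q (mem_intent_of_le inf_le_left hq),
      fun q hq => h q (mem_intent_of_le inf_le_right hq)⟩
  · rintro ⟨hX, hY⟩
    obtain ⟨p₁, _, hp₁, hr₁⟩ := exists_mem_of_mem_extMod hX
    have h₁ : p₁ ∈ extMod α Y := fun q hq =>
      (hY q hq).congr (fun i => LatticeCon.rel_symm (hr₁ i)) fun i => (α i).rel_refl _
    obtain ⟨p₂, hle, hp₂, hr₂⟩ := exists_mem_of_mem_extMod h₁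
    have h₂ : p₂ ∈ (X ⊓ Y).1.extent := ⟨mem_extent_of_le hle hp₁, hp₂⟩
    exact fun q hq => (RelMod.of_rel α (mem_extent_iff.1 h₂ q hq)).congr
      (fun i => LatticeCon.rel_trans (hr₂ i) (hr₁ i)) fun i => (α i).rel_refl _

theorem intMod_sup : intMod α (X ⊔ Y) = intMod α X ∩ intMod α Y := by
  ext q
  constructor
  · intro h
    exact ⟨fun p hp => h p (mem_of_le le_sup_left hp), fun p hp => h p (mem_of_le le_sup_right hp)⟩
  · rintro ⟨hX, hY⟩
    obtain ⟨q', hq', hr⟩ := exists_mem_of_mem_intMod hX hY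
    exact fun p hp => (RelMod.of_rel α (mem_intent_iff.1 hq' p hp)).congr
      (fun i => (α i).rel_refl _) hr

theorem extMod_eq_iff : extMod α X = extMod α Y ↔ intMod α X = intMod α Y := by
  constructor
  · intro h
    ext q
    rw [mem_intMod_iff, mem_intMod_iff, h]
  · intro h
    ext p
    rw [mem_extMod_iff, mem_extMod_iff, h]

/-- The congruence of the box product that identifies elements with the same rectangles modulo
the congruences `α i`. -/
def kernelCon (α : ∀ i, LatticeCon (A i)) : LatticeCon (BoxProd A) where
  r X Y := extMod α X = extMod α Y
  iseqv := ⟨fun _ => rfl, fun h => h.symm, fun h k => h.trans k⟩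
  inf h k := by rw [extMod_inf, extMod_inf, h, k]
  sup h k := by
    rw [extMod_eq_iff] at *
    rw [intMod_sup, intMod_sup, h, k]

theorem kernelCon_rel_addRect {p : Rect A} (h : p ∈ extMod α X) :
    (kernelCon α).r X (X.addRect p) := by
  refine Set.Subset.antisymm (fun r hr q hq => hr q (mem_intent_of_le (le_addRect _ _) hq))
    fun r hr q hq => ?_
  obtain ⟨q', hle, hr', hq'⟩ := exists_box_of_relMod {p} (by simpa using h q hq)
  have : q' ∈ (X.addRect p).1.intent := mem_intent_addRect.2
    ⟨mem_intent_iff.2 fun s hs => (mem_intent_iff.1 hq s hs).mono le_rfl hle, hq' p (by simp)⟩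
  exact (hr q' this).congr (fun i => (α i).rel_refl _) hr'

theorem mem_extMod_of_rel {p p' : Rect A} (h : p' ∈ X.1.extent)
    (hr : ∀ i, (α i).r (p'.1 i) (p.1 i)) : p ∈ extMod α X :=
  fun q hq => (RelMod.of_rel α (mem_extent_iff.1 h q hq)).congr hr fun i => (α i).rel_refl _

variable [HasAnchors A]

theorem models_kernelCon {p : Rect A} {q : Box A} :
    Models (kernelCon α) p q ↔ RelMod α p q := by
  obtain ⟨z, hz, -⟩ := HasAnchors.exists_fits {p} {q}
  have hq : q ∈ z.1.intent := hz q (by simp)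
  constructor
  · intro h
    have h₁ : extMod α ((z.addRect p).meetBox q) = extMod α (z.addRect p) := h z hq
    have h₂ : p ∈ extMod α ((z.addRect p).meetBox q) := h₁ ▸ mem_extMod_of_mem (mem_addRect z p)
    exact h₂ q (le_meetBox.1 le_rfl).2
  · rintro ⟨i, hi⟩
    have hmem : p.update i (p.1 i ⊓ q.1 i) ∈ ((z.addRect p).meetBox q).1.extent :=
      mem_meetBox.2 ⟨mem_extent_of_le (p.update_le inf_le_left) (mem_addRect _ _), i, by simp⟩
    have h := kernelCon_rel_addRect (mem_extMod_of_rel (α := α) (p := p) hmem fun j => by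
      by_cases hj : j = i
      · subst hj
        rw [Rect.update_self]
        exact hi
      · rw [Rect.update_of_ne _ _ hj])
    exact Models.of_exists (LatticeCon.rel_of_le_of_le h (meetBox_le _ _)
      (addRect_mono (le_meetBox.2 ⟨le_addRect _ _, hq⟩) le_rfl)).1

theorem tens_le_kernelCon {s : ∀ i, LatticeCon (A i)} {i : I} (h : s i ≤ α i) :
    tens s ≤ kernelCon α :=
  tens_le_iff.2 fun _ _ hpq => models_kernelCon.2 ⟨i, (hpq i).mono h⟩

theorem exists_le_of_tens_le_kernelCon {s : ∀ i, LatticeCon (A i)} (hfin : {i | s i ≠ ⊤}.Finite)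
    (p₀ : Rect A) (q₀ : Box A) (h : tens s ≤ kernelCon α) : ∃ i, s i ≤ α i := by
  classical
  by_contra! hc
  have hx : ∀ i, ∃ x y, (s i).Below x y ∧ ¬ (α i).Below x y := fun i => by
    by_contra! hn
    exact hc i (LatticeCon.le_of_forall_below hn)
  choose x y hs hα using hx
  have htop : ∀ i, IsTop (p₀.1 i) → IsBot (q₀.1 i) → ¬ (α i).Below (p₀.1 i) (q₀.1 i) :=
    fun i ht hb hr => hc i (le_top.trans
      ((LatticeCon.excess_eq_top ht hb).ge.trans (LatticeCon.excess_le.2 hr)))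
  let J : Set I := {i | s i ≠ ⊤} ∪ {i | ¬ IsTop (p₀.1 i)} ∪ {i | ¬ IsBot (q₀.1 i)}
  have hJ : J.Finite := (hfin.union p₀.2).union q₀.2
  let p : Rect A := ⟨fun i => if i ∈ J then x i else p₀.1 i, hJ.subset fun i hi => by
    by_contra hn
    have hi' : ¬ IsTop (if i ∈ J then x i else p₀.1 i) := hi
    rw [if_neg hn] at hi'
    exact hn (Or.inl (Or.inr hi'))⟩
  let q : Box A := ⟨fun i => if i ∈ J then y i else q₀.1 i, hJ.subset fun i hi => by
    by_contra hn
    have hi' : ¬ IsBot (if i ∈ J then y i else q₀.1 i) := hi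
    rw [if_neg hn] at hi'
    exact hn (Or.inr hi')⟩
  obtain ⟨i, hi⟩ := models_kernelCon.1 (tens_le_iff.1 h p q fun i => by
    change (s i).Below (if i ∈ J then x i else p₀.1 i) (if i ∈ J then y i else q₀.1 i)
    by_cases hi : i ∈ J
    · rw [if_pos hi, if_pos hi]
      exact hs i
    · have : s i = ⊤ := by
        by_contra hn
        exact hi (Or.inl (Or.inl hn))
      exact (LatticeCon.below_top _ _).mono this.ge)
  change (α i).Below (if i ∈ J then x i else p₀.1 i) (if i ∈ J then y i else q₀.1 i) at hi
  by_cases hiJ : i ∈ J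
  · rw [if_pos hiJ, if_pos hiJ] at hi
    exact hα i hi
  · rw [if_neg hiJ, if_neg hiJ] at hi
    simp only [J, Set.mem_union, Set.mem_ofPred_eq, not_or, not_not] at hiJ
    exact htop i hiJ.1.2 hiJ.2 hi

/-! #### Compact congruences of the box product -/

theorem sSup_tens_excessTuple (θ : LatticeCon (BoxProd A)) :
    sSup {φ | ∃ p q, Models θ p q ∧ φ = tens (excessTuple p q)} = θ := by
  refine le_antisymm (sSup_le ?_) (le_of_models fun p q h => ?_)
  · rintro _ ⟨p, q, h, rfl⟩
    exact tens_excessTuple_le.2 h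
  · exact tens_excessTuple_le.1 (le_sSup ⟨p, q, h, rfl⟩)

theorem nonempty_conc_orderIso {T G : Type*} [SemilatticeSup T] [OrderBot T] (g : G → T)
    (σ : G → ∀ i, LatticeCon (A i)) (ε : SupBotHom T (LatticeCon (BoxProd A)))
    (hg : ∀ t, ∃ F : Finset G, t = F.sup g) (hε : ∀ x, ε (g x) = tens (σ x))
    (hc : ∀ x i, IsCompactElement (σ x i)) (hfin : ∀ x, {i | σ x i ≠ ⊤}.Finite)
    (hsep : ∀ x v, ¬ g x ≤ v → ∃ (α : ∀ i, LatticeCon (A i)) (F : Finset G),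
      (∀ i, ¬ σ x i ≤ α i) ∧ v = F.sup g ∧ ∀ y ∈ F, ∃ i, σ y i ≤ α i)
    (hsurj : ∀ p q, ∃ t, ε t = tens (excessTuple p q)) (p₀ : Rect A) (q₀ : Box A) :
    Nonempty (Conc (BoxProd A) ≃o T) := by
  have hcomp : ∀ t, IsCompactElement (ε t) := fun t => by
    obtain ⟨F, rfl⟩ := hg t
    rw [map_finset_sup]
    refine CompleteLattice.isCompactElement_finsetSup _ fun x _ => ?_
    rw [Function.comp_apply, hε]
    exact isCompactElement_tens (hc x) (hfin x) p₀ q₀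
  have hle : ∀ u v, ε u ≤ ε v ↔ u ≤ v := fun u v => by
    refine ⟨fun h => ?_, fun h => OrderHomClass.mono ε h⟩
    obtain ⟨F, hF⟩ := hg u
    rw [hF]
    refine Finset.sup_le fun x hx => ?_
    by_contra hn
    obtain ⟨α, F', hα, hF', hv⟩ := hsep x v hn
    have hvα : ε v ≤ kernelCon α := by
      rw [hF', map_finset_sup]
      refine Finset.sup_le fun y hy => ?_
      rw [Function.comp_apply, hε]
      obtain ⟨i, hi⟩ := hv y hy
      exact tens_le_kernelCon hi
    have hxu : g x ≤ u := hF ▸ Finset.le_sup hx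
    have hxα : tens (σ x) ≤ kernelCon α :=
      (hε x).ge.trans ((OrderHomClass.mono ε hxu).trans (h.trans hvα))
    obtain ⟨i, hi⟩ := exists_le_of_tens_le_kernelCon (hfin x) p₀ q₀ hxα
    exact hα i hi
  have hrange : ∀ θ : LatticeCon (BoxProd A), IsCompactElement θ → ∃ t, ε t = θ := fun θ hθ => by
    classical
    obtain ⟨F, hF, hθF⟩ :=
      (CompleteLattice.isCompactElement_iff_exists_le_sSup_of_le_sSup _ θ).1 hθ _
        (sSup_tens_excessTuple θ).ge
    have hsup : F.sup id = θ := le_antisymm (Finset.sup_le fun φ hφ =>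
      (le_sSup (hF hφ)).trans (sSup_tens_excessTuple θ).le) hθF
    rw [← hsup]
    refine Finset.sup_induction (p := fun φ => ∃ t, ε t = φ) ⟨⊥, map_bot ε⟩ ?_ ?_
    · rintro _ ⟨s, rfl⟩ _ ⟨t, rfl⟩
      exact ⟨s ⊔ t, map_sup ε s t⟩
    · intro φ hφ
      obtain ⟨p, q, _, rfl⟩ := hF hφ
      exact hsurj p q
  let f : T ↪o Conc (BoxProd A) := OrderEmbedding.ofMapLEIff (fun t => ⟨ε t, hcomp t⟩) hle
  have hf : Function.Surjective f := fun θ => by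
    obtain ⟨t, ht⟩ := hrange θ.1 θ.2
    exact ⟨t, Subtype.ext ht⟩
  exact ⟨(RelIso.ofSurjective f hf).symm⟩

end BoxProd

/-! ### Multi-ideals of compact congruences -/

section MultiIdeal

variable {ι : Type u} {A : ι → Type u} [∀ i, Lattice (A i)]

/-- A set of tuples of compact congruences corresponding to an ideal of the tensor product. -/
structure IsMultiIdeal (N : Set (∀ i, Conc (A i))) : Prop where
  lower : ∀ {x y : ∀ i, Conc (A i)}, x ≤ y → y ∈ N → x ∈ N
  bot : ∀ {x : ∀ i, Conc (A i)} {i : ι}, x i = ⊥ → x ∈ N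
  sup : ∀ {x y z : ∀ i, Conc (A i)} {i : ι}, z i = x i ⊔ y i →
    (∀ j, j ≠ i → x j = z j ∧ y j = z j) → x ∈ N → y ∈ N → z ∈ N

theorem IsMultiIdeal.sUnion {c : Set (Set (∀ i, Conc (A i)))} (hc : ∀ N ∈ c, IsMultiIdeal N)
    (hch : IsChain (· ⊆ ·) c) (hne : c.Nonempty) : IsMultiIdeal (⋃₀ c) where
  lower h := fun ⟨N, hN, hy⟩ => ⟨N, hN, (hc N hN).lower h hy⟩
  bot h := let ⟨N, hN⟩ := hne
    ⟨N, hN, (hc N hN).bot h⟩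
  sup h h' := by
    rintro ⟨N, hN, hx⟩ ⟨N', hN', hy⟩
    rcases hch.total hN hN' with hle | hle
    · exact ⟨N', hN', (hc N' hN').sup h h' (hle hx) hy⟩
    · exact ⟨N, hN, (hc N hN).sup h h' hx (hle hy)⟩

open Classical in
/-- The enlargement of a multi-ideal by a prime congruence in one coordinate. -/
theorem IsMultiIdeal.enlarge {N : Set (∀ i, Conc (A i))} (hN : IsMultiIdeal N) {i : ι}
    {π : LatticeCon (A i)} {c₀ : Conc (A i)} (hc₀ : ¬ c₀.1 ≤ π)
    (hπ : ∀ β γ, ¬ β ≤ π → ¬ γ ≤ π → ¬ β ⊓ γ ≤ π) :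
    IsMultiIdeal {y | (y i).1 ≤ π ∨ ∃ c : Conc (A i), ¬ c.1 ≤ π ∧ Function.update y i c ∈ N} where
  lower := by
    rintro x y hxy (h | ⟨c, hc, h⟩)
    · exact Or.inl (le_trans (hxy i) h)
    · exact Or.inr ⟨c, hc, hN.lower (update_le_update_iff.2
        ⟨le_rfl, fun j _ => hxy j⟩) h⟩
  bot := by
    intro x j hj
    by_cases hji : j = i
    · subst hji
      left
      rw [hj]
      exact bot_le
    · exact Or.inr ⟨c₀, hc₀, hN.bot (i := j) (by rwa [Function.update_of_ne hji])⟩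
  sup := by
    intro x y z j hz hne hx hy
    by_cases hji : j = i
    · subst hji
      have hux : ∀ c, Function.update x j c = Function.update z j c := fun c => funext fun k => by
        by_cases hk : k = j
        · subst hk
          simp
        · rw [Function.update_of_ne hk, Function.update_of_ne hk, (hne k hk).1]
      have huy : ∀ c, Function.update y j c = Function.update z j c := fun c => funext fun k => by
        by_cases hk : k = j
        · subst hk
          simp
        · rw [Function.update_of_ne hk, Function.update_of_ne hk, (hne k hk).2]
      rcases hx with hx | ⟨c, hc, hx⟩
      · rcases hy with hy | ⟨c, hc, hy⟩
        · left
          rw [hz]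
          exact sup_le hx hy
        · exact Or.inr ⟨c, hc, huy c ▸ hy⟩
      · exact Or.inr ⟨c, hc, hux c ▸ hx⟩
    · have hij : i ≠ j := fun h => hji h.symm
      obtain ⟨hxi, hyi⟩ := hne i hij
      rcases hx with hx | ⟨c, hc, hx⟩
      · left
        rwa [← hxi]
      rcases hy with hy | ⟨c', hc', hy⟩
      · left
        rwa [← hyi]
      obtain ⟨γ, hle, hγπ⟩ : ∃ γ : Conc (A i), γ.1 ≤ c.1 ⊓ c'.1 ∧ ¬ γ.1 ≤ π :=
        let ⟨γ, hγ, hle, hγπ⟩ := LatticeCon.exists_compact_not_le (hπ _ _ hc hc')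
        ⟨⟨γ, hγ⟩, hle, hγπ⟩
      refine Or.inr ⟨γ, hγπ, hN.sup (i := j) (x := Function.update x i γ)
        (y := Function.update y i γ) ?_ (fun k hk => ?_) (hN.lower ?_ hx) (hN.lower ?_ hy)⟩
      · rw [Function.update_of_ne hji, Function.update_of_ne hji, Function.update_of_ne hji, hz]
      · by_cases hki : k = i
        · subst hki
          simp
        · rw [Function.update_of_ne hki, Function.update_of_ne hki, Function.update_of_ne hki]
          exact hne k hk
      · exact update_le_update_iff.2 ⟨(hle.trans inf_le_left : γ.1 ≤ c.1), fun j _ => le_rfl⟩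
      · exact update_le_update_iff.2 ⟨(hle.trans inf_le_right : γ.1 ≤ c'.1), fun j _ => le_rfl⟩

/-- A multi-ideal is separated from a tuple outside of it by a tuple of congruences. -/
theorem IsMultiIdeal.exists_separation [Finite ι] {N : Set (∀ i, Conc (A i))}
    (hN : IsMultiIdeal N) {x : ∀ i, Conc (A i)} (hx : x ∉ N) :
    ∃ α : ∀ i, LatticeCon (A i), (∀ i, ¬ (x i).1 ≤ α i) ∧ ∀ y ∈ N, ∃ i, (y i).1 ≤ α i := by
  classical
  obtain ⟨M, hNM, hM⟩ := zorn_subset_nonempty {N : Set (∀ i, Conc (A i)) | IsMultiIdeal N ∧ x ∉ N}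
    (fun c hc hch hne => ⟨⋃₀ c, ⟨IsMultiIdeal.sUnion (fun N hN => (hc hN).1) hch hne,
      fun ⟨N, hN, h⟩ => (hc hN).2 h⟩, fun N hN => Set.subset_sUnion_of_mem hN⟩) N ⟨hN, hx⟩
  obtain ⟨⟨hMI, hxM⟩, hmax⟩ := hM
  have hα : ∀ i, ∃ π : LatticeCon (A i), ¬ (x i).1 ≤ π ∧
      (∀ β γ, ¬ β ≤ π → ¬ γ ≤ π → ¬ β ⊓ γ ≤ π) ∧
      ∀ c : Conc (A i), Function.update x i c ∈ M → c.1 ≤ π := by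
    intro i
    let S : Set (LatticeCon (A i)) := {β | ∃ c : Conc (A i), Function.update x i c ∈ M ∧ c.1 = β}
    have hS : ¬ (x i).1 ≤ sSup S := fun h => by
      obtain ⟨_, ⟨c, hc, rfl⟩, hle⟩ :=
        (CompleteLattice.isCompactElement_iff_le_of_directed_sSup_le _ _).1 (x i).2 S
          ⟨_, ⊥, hMI.bot (i := i) (by simp), rfl⟩ (by
            rintro _ ⟨c, hc, rfl⟩ _ ⟨d, hd, rfl⟩
            refine ⟨_, ⟨c ⊔ d, ?_, rfl⟩, (le_sup_left : c ≤ c ⊔ d), (le_sup_right : d ≤ c ⊔ d)⟩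
            exact hMI.sup (i := i) (by simp) (fun j hj => by simp [hj]) hc hd) h
      refine hxM (hMI.lower ?_ hc)
      rw [le_update_iff]
      exact ⟨hle, fun j _ => le_rfl⟩
    obtain ⟨π, hSπ, hxπ, hπ⟩ := LatticeCon.exists_prime (x i).2 hS
    exact ⟨π, hxπ, hπ, fun c hc => (show c.1 ≤ sSup S from le_sSup ⟨c, hc, rfl⟩).trans hSπ⟩
  choose α hxα hprime hupd using hα
  have hsat : ∀ i (y : ∀ i, Conc (A i)) (c : Conc (A i)), ¬ c.1 ≤ α i →
      Function.update y i c ∈ M → y ∈ M := fun i y c hc hy => by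
    refine hmax ⟨hMI.enlarge (hxα i) (hprime i), ?_⟩ (fun z hz => ?_) (Or.inr ⟨c, hc, hy⟩)
    · rintro (h | ⟨c, hc, h⟩)
      · exact hxα i h
      · exact hc (hupd i c h)
    · by_cases hz' : (z i).1 ≤ α i
      · exact Or.inl hz'
      · exact Or.inr ⟨z i, hz', by rwa [Function.update_eq_self]⟩
  refine ⟨α, hxα, fun y hy => ?_⟩
  by_contra! hc
  have := Fintype.ofFinite ι
  have key : ∀ J : Finset ι, J.piecewise x y ∈ M := fun J => by
    induction J using Finset.induction with
    | empty => simpa using hNM hy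
    | insert i J hi ih =>
      refine hsat i _ (y i) (hc i) ?_
      rw [Finset.piecewise_insert, Function.update_idem]
      have : J.piecewise x y i = y i := by simp [hi]
      rw [← this, Function.update_eq_self]
      exact ih
  exact hxM (by simpa using key Finset.univ)

end MultiIdeal

/-! ### Permutable congruences -/

namespace LatticeCon

variable {L : Type u} [Lattice L]

/-- Permutability of two congruences, expressed on ascending pairs of steps. -/
def AscPerm (θ φ : LatticeCon L) : Prop :=
  ∀ x y z, x ≤ y → y ≤ z → θ.r x y → φ.r y z → ∃ t, x ≤ t ∧ t ≤ z ∧ φ.r x t ∧ θ.r t z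

theorem hasPermutableCongruences_iff :
    HasPermutableCongruences L ↔ ∀ θ φ : LatticeCon L, AscPerm θ φ := by
  constructor
  · intro h θ φ x y z hxy hyz hθ hφ
    have h₁ : Relation.Comp θ.r φ.r x z := ⟨y, hθ, hφ⟩
    rw [h] at h₁
    obtain ⟨t, hφt, hθt⟩ := h₁
    refine ⟨(t ⊔ x) ⊓ z, le_inf le_sup_right (hxy.trans hyz), inf_le_right, ?_, ?_⟩
    · have := rel_inf_right (rel_sup_right hφt x) z
      rwa [sup_idem, inf_eq_left.2 (hxy.trans hyz)] at this
    · have := rel_inf_right (rel_sup_right hθt x) z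
      rwa [sup_eq_left.2 (hxy.trans hyz), inf_idem] at this
  · intro h
    have key : ∀ (θ φ : LatticeCon L) (x z : L),
        Relation.Comp θ.r φ.r x z → Relation.Comp φ.r θ.r x z := by
      rintro θ φ x z ⟨y, hθ, hφ⟩
      have h₁ : θ.r x (x ⊔ y) := by
        simpa [sup_comm] using rel_sup_right hθ x
      have h₂ : φ.r (x ⊔ y) (x ⊔ y ⊔ z) := by
        have := rel_sup_right hφ (x ⊔ y)
        rwa [sup_eq_right.2 (le_sup_right : y ≤ x ⊔ y), sup_comm z] at this
      have h₃ : φ.r z (z ⊔ y) := by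
        simpa [sup_comm] using rel_sup_right (rel_symm hφ) z
      have h₄ : θ.r (z ⊔ y) (x ⊔ y ⊔ z) := by
        have := rel_sup_right (rel_symm hθ) (z ⊔ y)
        rwa [sup_eq_right.2 (le_sup_right : y ≤ z ⊔ y), sup_comm z y, ← sup_assoc,
          sup_comm y z] at this
      obtain ⟨t₁, hxt, ht₁, hφ₁, hθ₁⟩ := h θ φ _ _ _ le_sup_left le_sup_left h₁ h₂
      obtain ⟨t₂, hzt, ht₂, hθ₂, hφ₂⟩ := h φ θ _ _ _ le_sup_left
        (sup_le le_sup_right (le_sup_right.trans le_sup_left)) h₃ h₄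
      refine ⟨t₁ ⊓ t₂, ?_, ?_⟩
      · have := φ.inf (φ.rel_refl t₁) (rel_symm hφ₂)
        rw [inf_eq_left.2 ht₁] at this
        exact rel_trans hφ₁ this
      · have := θ.inf hθ₁ (θ.rel_refl t₂)
        rw [inf_eq_right.2 ht₂] at this
        exact rel_trans this (rel_symm hθ₂)
    intro θ φ
    funext x z
    exact propext ⟨key θ φ x z, key φ θ x z⟩

variable {θ φ θ' φ' : LatticeCon L}

theorem AscPerm.inf_right (h : AscPerm θ φ) (h' : AscPerm θ φ') : AscPerm θ (φ ⊓ φ') := by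
  intro x y z hxy hyz hθ hφ
  rw [rel_inf] at hφ
  obtain ⟨t, hxt, htz, h₁, h₂⟩ := h x y z hxy hyz hθ hφ.1
  obtain ⟨t', hxt', htz', h₁', h₂'⟩ := h' x y z hxy hyz hθ hφ.2
  refine ⟨t ⊓ t', le_inf hxt hxt', inf_le_left.trans htz, rel_inf.2
    ⟨(rel_of_le_of_le h₁ (le_inf hxt hxt') inf_le_left).1,
      (rel_of_le_of_le h₁' (le_inf hxt hxt') inf_le_right).1⟩, ?_⟩
  simpa using θ.inf h₂ h₂'

theorem AscPerm.inf_left (h : AscPerm θ φ) (h' : AscPerm θ' φ) : AscPerm (θ ⊓ θ') φ := by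
  intro x y z hxy hyz hθ hφ
  rw [rel_inf] at hθ
  obtain ⟨t, hxt, htz, h₁, h₂⟩ := h x y z hxy hyz hθ.1 hφ
  obtain ⟨t', hxt', htz', h₁', h₂'⟩ := h' x y z hxy hyz hθ.2 hφ
  refine ⟨t ⊔ t', hxt.trans le_sup_left, sup_le htz htz', ?_, rel_inf.2
    ⟨(rel_of_le_of_le h₂ le_sup_left (sup_le htz htz')).2,
      (rel_of_le_of_le h₂' le_sup_right (sup_le htz htz')).2⟩⟩
  simpa using φ.sup h₁ h₁'

theorem AscPerm.top_right (θ : LatticeCon L) : AscPerm θ ⊤ :=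
  fun _ _ z hxy hyz _ _ => ⟨z, hxy.trans hyz, le_rfl, rel_top _ _, θ.rel_refl z⟩

theorem AscPerm.top_left (φ : LatticeCon L) : AscPerm ⊤ φ :=
  fun x _ _ hxy hyz _ _ => ⟨x, le_rfl, hxy.trans hyz, φ.rel_refl x, rel_top _ _⟩

theorem AscPerm.finsetInf {ι κ : Type*} {s : Finset ι} {t : Finset κ} {f : ι → LatticeCon L}
    {g : κ → LatticeCon L} (h : ∀ i ∈ s, ∀ j ∈ t, AscPerm (f i) (g j)) :
    AscPerm (s.inf f) (t.inf g) :=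
  Finset.inf_induction (p := fun θ => AscPerm θ (t.inf g)) (AscPerm.top_left _)
    (fun _ h₁ _ h₂ => h₁.inf_left h₂) fun i hi =>
      Finset.inf_induction (p := fun φ => AscPerm (f i) φ) (AscPerm.top_right _)
        (fun _ h₁ _ h₂ => h₁.inf_right h₂) fun j hj => h i hi j hj

theorem AscPerm.sSup_right {S : Set (LatticeCon L)} (h : ∀ φ ∈ S, AscPerm θ φ) :
    AscPerm θ (sSup S) := by
  intro x y z hxy hyz hθ hφ
  rw [rel_sSup_iff hyz] at hφ
  have key : ∀ z, Chain S y z → ∃ t, x ≤ t ∧ t ≤ z ∧ (sSup S).r x t ∧ θ.r t z := by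
    intro z hc
    induction hc with
    | refl => exact ⟨x, le_rfl, hxy, rel_refl _ x, hθ⟩
    | tail _ hbc ih =>
      obtain ⟨hle, φ, hφ, hr⟩ := hbc
      obtain ⟨t, hxt, htb, h₁, h₂⟩ := ih
      obtain ⟨t', htt', ht'c, h₁', h₂'⟩ := h φ hφ _ _ _ htb hle h₂ hr
      exact ⟨t', hxt.trans htt', ht'c, rel_trans h₁ (le_def.1 (le_sSup hφ) _ _ h₁'), h₂'⟩
  exact key z hφ

theorem AscPerm.sSup_left {S : Set (LatticeCon L)} (h : ∀ θ ∈ S, AscPerm θ φ) :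
    AscPerm (sSup S) φ := by
  intro x y z hxy hyz hθ hφ
  rw [rel_sSup_iff hxy] at hθ
  clear hxy
  induction hθ using Relation.ReflTransGen.head_induction_on with
  | refl => exact ⟨z, hyz, le_rfl, hφ, rel_refl _ z⟩
  | head hab hc ih =>
    obtain ⟨hle, θ, hθ, hr⟩ := hab
    obtain ⟨t, hbt, htz, h₁, h₂⟩ := ih
    obtain ⟨t', hat', ht't, h₁', h₂'⟩ := h θ hθ _ _ _ hle hbt hr h₁
    exact ⟨t', hat', ht't.trans htz, h₁', rel_trans (le_def.1 (le_sSup hθ) _ _ h₂') h₂⟩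

end LatticeCon

namespace BoxProd

variable {I : Type u} {A : I → Type u} [∀ i, Lattice (A i)]

theorem exists_between {θ φ : LatticeCon (BoxProd A)} {H N : BoxProd A} (hHN : H ≤ N)
    (h : ∀ p ∈ N.1.extent, ∃ r ≤ p, φ.r H (H.addRect r) ∧
      θ.r (H.addRect r) ((H.addRect r).addRect p)) :
    ∃ T, H ≤ T ∧ T ≤ N ∧ φ.r H T ∧ θ.r T N := by
  classical
  obtain ⟨F, hF⟩ := N.2.1
  have key : ∀ F' ⊆ F, ∃ V, H ≤ V ∧ V ≤ N ∧ φ.r H V ∧ ∀ p ∈ F', θ.r V (V.addRect p) := by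
    intro F'
    induction F' using Finset.induction with
    | empty => exact fun _ => ⟨H, le_rfl, hHN, φ.rel_refl _, by simp⟩
    | insert p F' _ ih =>
      intro hsub
      rw [Finset.insert_subset_iff] at hsub
      obtain ⟨V, hV, hVN, hφ, hθ⟩ := ih hsub.2
      have hp : p ∈ N.1.extent := (hF p).2 (Or.inr ⟨p, hsub.1, le_rfl⟩)
      obtain ⟨r, hrp, h₁, h₂⟩ := h p hp
      refine ⟨V.addRect r, hV.trans (le_addRect _ _),
        addRect_le.2 ⟨hVN, mem_extent_of_le hrp hp⟩, ?_, fun p' hp' => ?_⟩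
      · have := LatticeCon.rel_sup_right h₁ V
        rw [sup_addRect hV, sup_eq_right.2 hV] at this
        exact LatticeCon.rel_trans hφ this
      · rcases Finset.mem_insert.1 hp' with rfl | hp'
        · have := LatticeCon.rel_sup_right h₂ (V.addRect r)
          rwa [sup_addRect (addRect_mono hV le_rfl),
            sup_eq_right.2 (addRect_mono hV le_rfl)] at this
        · have := LatticeCon.rel_sup_right (hθ p' hp') (V.addRect r)
          rwa [sup_addRect (le_addRect _ _), sup_eq_right.2 (le_addRect _ _)] at this
  obtain ⟨T, hHT, hTN, hφ, hθ⟩ := key F subset_rfl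
  refine ⟨T, hHT, hTN, hφ, ?_⟩
  have := rel_sup_of_forall_addRect (θ := θ) (X := N) (Y := T) fun p hp => by
    rcases (hF p).1 hp with hn | ⟨p', hp', hle⟩
    · rw [addRect_of_mem (mem_extent_of_null hn)]
    · exact (LatticeCon.rel_of_le_of_le (hθ p' hp') (le_addRect _ _) (addRect_mono le_rfl hle)).1
  rwa [sup_eq_right.2 hTN] at this

open Classical in
/-- The congruence of the box product given by a congruence of one factor. -/
def coordKer (i : I) (s : LatticeCon (A i)) : LatticeCon (BoxProd A) :=
  kernelCon (Function.update (fun _ => ⊥) i s)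

theorem exists_mem_of_coordKer {i : I} {s : LatticeCon (A i)} {X Y : BoxProd A}
    (h : (coordKer i s).r X Y) {p : Rect A} (hp : p ∈ Y.1.extent) :
    ∃ p' ≤ p, p' ∈ X.1.extent ∧ s.r (p'.1 i) (p.1 i) ∧ ∀ j, j ≠ i → p'.1 j = p.1 j := by
  classical
  have hX : p ∈ extMod (Function.update (fun _ => ⊥) i s) X :=
    (show extMod _ X = extMod _ Y from h) ▸ mem_extMod_of_mem hp
  obtain ⟨p', hle, hp', hr⟩ := exists_mem_of_mem_extMod hX
  refine ⟨p', hle, hp', ?_, fun j hj => ?_⟩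
  · have := hr i
    rwa [Function.update_self] at this
  have := hr j
  rw [Function.update_of_ne hj] at this
  exact LatticeCon.rel_bot.1 this

theorem coordKer_rel_addRect {i : I} {s : LatticeCon (A i)} {X : BoxProd A} {p p' : Rect A}
    (hp' : p' ∈ X.1.extent) (hr : s.r (p'.1 i) (p.1 i)) (hne : ∀ j, j ≠ i → p'.1 j = p.1 j) :
    (coordKer i s).r X (X.addRect p) := by
  classical
  refine kernelCon_rel_addRect (mem_extMod_of_rel hp' fun j => ?_)
  by_cases hj : j = i
  · subst hj
    rwa [Function.update_self]
  · rw [Function.update_of_ne hj]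
    exact LatticeCon.rel_bot.2 (hne j hj)

theorem ascPerm_coordKer {i j : I} {s : LatticeCon (A i)} {t : LatticeCon (A j)}
    (h : ∀ s t : LatticeCon (A i), s.AscPerm t) : (coordKer i s).AscPerm (coordKer j t) := by
  intro H K N hHK hKN hs ht
  refine exists_between (hHK.trans hKN) fun p hp => ?_
  obtain ⟨p₁, hle₁, hp₁, hr₁, hne₁⟩ := exists_mem_of_coordKer ht hp
  obtain ⟨p₂, hle₂, hp₂, hr₂, hne₂⟩ := exists_mem_of_coordKer hs hp₁
  by_cases hij : i = j
  · subst hij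
    obtain ⟨x, hx, hx', h₁, h₂⟩ := h s t _ _ _ (hle₂ i) (hle₁ i) hr₂ hr₁
    refine ⟨p.update i x, p.update_le hx', coordKer_rel_addRect hp₂ (by simpa using h₁)
      fun k hk => ?_, coordKer_rel_addRect (mem_addRect _ _) (by simpa using h₂) fun k hk => ?_⟩
    · rw [Rect.update_of_ne _ _ hk, hne₂ k hk, hne₁ k hk]
    · rw [Rect.update_of_ne _ _ hk]
  · have hji : j ≠ i := fun h => hij h.symm
    refine ⟨p.update i (p₂.1 i), p.update_le ((hle₂ i).trans (hle₁ i)),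
      coordKer_rel_addRect hp₂ ?_ fun k hk => ?_,
      coordKer_rel_addRect (mem_addRect _ _) ?_ fun k hk => ?_⟩
    · rw [Rect.update_of_ne _ _ hji, hne₂ j hji]
      exact hr₁
    · by_cases hki : k = i
      · subst hki
        simp
      · rw [Rect.update_of_ne _ _ hki, hne₂ k hki, hne₁ k hk]
    · rw [Rect.update_self, ← hne₁ i hij]
      exact hr₂
    · rw [Rect.update_of_ne _ _ hk]

variable [HasAnchors A]

theorem models_coordKer {i : I} {s : LatticeCon (A i)} {p : Rect A} {q : Box A} :
    Models (coordKer i s) p q ↔ Rel p q ∨ s.Below (p.1 i) (q.1 i) := by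
  classical
  refine models_kernelCon.trans ⟨fun ⟨j, hj⟩ => ?_, ?_⟩
  · by_cases hji : j = i
    · subst hji
      exact Or.inr (by simpa using hj)
    · rw [Function.update_of_ne hji] at hj
      exact Or.inl ⟨j, LatticeCon.below_bot.1 hj⟩
  · rintro (h | h)
    · exact RelMod.of_rel _ h
    · exact ⟨i, by simpa using h⟩

theorem tens_excessTuple_eq_inf (p : Rect A) (q : Box A) :
    tens (excessTuple p q) =
      (finite_excessTuple_ne_top p q).toFinset.inf fun i => coordKer i (excessTuple p q i) := by
  apply le_antisymm
  · exact Finset.le_inf fun i _ => tens_excessTuple_le.2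
      (models_coordKer.2 (Or.inr (LatticeCon.below_excess _ _)))
  · refine le_of_models fun p' q' h => ?_
    by_cases hrel : Rel p' q'
    · exact Models.of_rel _ hrel
    refine models_tens fun i => ?_
    by_cases hi : excessTuple p q i = ⊤
    · rw [hi]
      exact LatticeCon.below_top _ _
    · exact (models_coordKer.1 (h.mono (Finset.inf_le
        ((finite_excessTuple_ne_top p q).mem_toFinset.2 hi)))).resolve_left hrel

theorem hasPermutableCongruences (h : ∀ i, HasPermutableCongruences (A i)) :
    HasPermutableCongruences (BoxProd A) := by
  refine LatticeCon.hasPermutableCongruences_iff.2 fun θ φ => ?_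
  rw [← sSup_tens_excessTuple θ, ← sSup_tens_excessTuple φ]
  refine LatticeCon.AscPerm.sSup_left ?_
  rintro _ ⟨p, q, -, rfl⟩
  refine LatticeCon.AscPerm.sSup_right ?_
  rintro _ ⟨p', q', -, rfl⟩
  rw [tens_excessTuple_eq_inf, tens_excessTuple_eq_inf]
  exact LatticeCon.AscPerm.finsetInf fun i _ j _ =>
    ascPerm_coordKer (LatticeCon.hasPermutableCongruences_iff.1 (h i))

end BoxProd

namespace BoxProd

section Bounds

variable {I : Type u} (A : I → Type u) [∀ i, Lattice (A i)]

/-- The box of least elements. -/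
def botBox [∀ i, OrderBot (A i)] : Box A := ⟨fun _ => ⊥, by simp⟩

/-- The rectangle of largest elements. -/
def topRect [∀ i, OrderTop (A i)] : Rect A := ⟨fun _ => ⊤, by simp⟩

variable {A}

theorem isFin_bot [∀ i, OrderBot (A i)] : IsFin (⊥ : Concept (Rect A) (Box A) Rel) := by
  have h : ∀ q, q ∈ (⊥ : Concept (Rect A) (Box A) Rel).intent := fun q =>
    le_box_iff.1 bot_le
  refine ⟨⟨∅, fun r => ⟨fun hr => Or.inl fun q => mem_extent_iff.1 hr q (h q), ?_⟩⟩,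
    ⟨{botBox A}, fun q => ⟨fun _ => Or.inr ⟨botBox A, by simp, fun i => bot_le⟩, fun _ => h q⟩⟩⟩
  rintro (hr | ⟨p, hp, -⟩)
  · exact mem_extent_of_null hr
  · simp at hp

theorem isFin_top [∀ i, OrderTop (A i)] : IsFin (⊤ : Concept (Rect A) (Box A) Rel) := by
  have h : ∀ p, p ∈ (⊤ : Concept (Rect A) (Box A) Rel).extent := fun p =>
    pure_le_iff.1 le_top
  refine ⟨⟨{topRect A}, fun q => ⟨fun _ => Or.inr ⟨topRect A, by simp, fun i => le_top⟩,
    fun _ => h q⟩⟩, ⟨∅, fun r => ⟨fun hr => Or.inl fun q => mem_intent_iff.1 hr q (h q), ?_⟩⟩⟩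
  rintro (hr | ⟨p, hp, -⟩)
  · exact mem_intent_of_triv hr
  · simp at hp

instance [∀ i, OrderBot (A i)] : OrderBot (BoxProd A) where
  bot := ⟨⊥, isFin_bot⟩
  bot_le X := (bot_le : ⊥ ≤ X.1)

instance [∀ i, OrderTop (A i)] : OrderTop (BoxProd A) where
  top := ⟨⊤, isFin_top⟩
  le_top X := (le_top : X.1 ≤ ⊤)

instance [∀ i, OrderBot (A i)] [∀ i, OrderTop (A i)] : BoundedOrder (BoxProd A) where

instance [∀ i, OrderBot (A i)] : HasAnchors A where
  exists_fits P Q := by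
    refine ⟨⊥, fun q _ => le_box_iff.1 (bot_le : (⊥ : Concept (Rect A) (Box A) Rel) ≤ _),
      fun p _ r hr => ?_⟩
    have hle : (⊥ : Concept (Rect A) (Box A) Rel) ⊔ pure p ≤ pure p := by rw [bot_sup_eq]
    rcases mem_extent_pure.1 (BoxProduct.le_iff.1 hle r hr) with h | h
    · exact Or.inl (mem_extent_of_null h)
    · exact Or.inr h

end Bounds

end BoxProd

/-! ### The box product of two lattices -/

/-- The index set of a pair. -/
inductive Side : Type u
  | left
  | right

instance : Finite Side.{u} :=
  Finite.of_surjective (fun b : Bool => cond b Side.left Side.right) fun s => by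
    cases s
    · exact ⟨true, rfl⟩
    · exact ⟨false, rfl⟩

/-- A pair of types as a family. -/
def PairFam (X Y : Type u) : Side.{u} → Type u
  | .left => X
  | .right => Y

instance (X Y : Type u) [Lattice X] [Lattice Y] : ∀ i, Lattice (PairFam X Y i)
  | .left => inferInstanceAs (Lattice X)
  | .right => inferInstanceAs (Lattice Y)

instance (X Y : Type u) [Lattice X] [Lattice Y] [OrderBot X] [OrderBot Y] :
    ∀ i, OrderBot (PairFam X Y i)
  | .left => inferInstanceAs (OrderBot X)
  | .right => inferInstanceAs (OrderBot Y)

instance (X Y : Type u) [Lattice X] [Lattice Y] [OrderTop X] [OrderTop Y] :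
    ∀ i, OrderTop (PairFam X Y i)
  | .left => inferInstanceAs (OrderTop X)
  | .right => inferInstanceAs (OrderTop Y)

namespace PairFam

variable {X Y : Type u} [Lattice X] [Lattice Y]

/-- The rectangle given by two elements. -/
def rect (x : X) (y : Y) : Rect (PairFam X Y) :=
  ⟨fun | .left => x | .right => y, Set.toFinite _⟩

/-- The box given by two elements. -/
def box (x : X) (y : Y) : Box (PairFam X Y) :=
  ⟨fun | .left => x | .right => y, Set.toFinite _⟩

theorem rel_iff {p : Rect (PairFam X Y)} {q : Box (PairFam X Y)} :
    Rel p q ↔ p.1 .left ≤ q.1 .left ∨ p.1 .right ≤ q.1 .right :=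
  ⟨fun ⟨i, hi⟩ => by
    cases i
    · exact Or.inl hi
    · exact Or.inr hi, fun h => h.elim (fun h => ⟨.left, h⟩) fun h => ⟨.right, h⟩⟩

theorem rect_le_iff {p r : Rect (PairFam X Y)} :
    r ≤ p ↔ r.1 .left ≤ p.1 .left ∧ r.1 .right ≤ p.1 .right :=
  ⟨fun h => ⟨h .left, h .right⟩, fun h i => by
    cases i
    · exact h.1
    · exact h.2⟩

theorem box_le_iff {p r : Box (PairFam X Y)} :
    r ≤ p ↔ r.1 .left ≤ p.1 .left ∧ r.1 .right ≤ p.1 .right :=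
  ⟨fun h => ⟨h .left, h .right⟩, fun h i => by
    cases i
    · exact h.1
    · exact h.2⟩

/-! #### A bounded lattice and an arbitrary lattice -/

section Bounded

variable [BoundedOrder X]

/-- The bi-ideal spanned by the largest element of `X` and an element of `Y` is also a box. -/
theorem mem_intent_pure_top {y : Y} {q : Box (PairFam X Y)} :
    q ∈ (BoxProduct.pure (rect (⊤ : X) y)).intent ↔ Triv q ∨ box (⊥ : X) y ≤ q := by
  rw [mem_intent_pure, rel_iff, box_le_iff]
  constructor
  · rintro (h | h)
    · exact Or.inl (triv_of_isTop (i := Side.left) ((isTop_top : IsTop (⊤ : X)).mono h))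
    · exact Or.inr ⟨(bot_le : (⊥ : X) ≤ _), h⟩
  · rintro (h | h)
    · exact rel_iff.1 (h _)
    · exact Or.inr h.2

/-- The element of the box product given by the largest element of `X` and an element of `Y`. -/
def anchor (y : Y) : BoxProd (PairFam X Y) :=
  ⟨BoxProduct.pure (rect (⊤ : X) y),
    ⟨{rect (⊤ : X) y}, fun r => by rw [mem_extent_pure]; simp⟩,
    ⟨{box (⊥ : X) y}, fun q => by rw [mem_intent_pure_top]; simp⟩⟩

theorem fits_anchor {p : Rect (PairFam X Y)} {y : Y} (h : y ≤ p.1 .right) :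
    BoxProd.Fits (anchor (X := X) y) p := by
  intro r hr
  have key : ∀ q, Rel (rect (⊤ : X) y) q → Rel p q → Rel r q := fun q h₁ h₂ =>
    mem_extent_iff.1 hr q (BoxProd.mem_intent_addRect.2 ⟨mem_intent_pure.2 h₁, h₂⟩)
  rcases rel_iff.1 (key (box (p.1 .left : X) y) (rel_iff.2 (Or.inr le_rfl))
    (rel_iff.2 (Or.inl le_rfl))) with h₁ | h₁
  · rcases rel_iff.1 (key (box (⊥ : X) (p.1 .right : Y)) (rel_iff.2 (Or.inr h))
      (rel_iff.2 (Or.inr le_rfl))) with h₂ | h₂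
    · exact Or.inl (mem_extent_of_null (null_of_isBot (i := Side.left)
        ((isBot_bot : IsBot (⊥ : X)).mono h₂)))
    · exact Or.inr (rect_le_iff.2 ⟨h₁, h₂⟩)
  · exact Or.inl (mem_extent_pure.2 (Or.inr (rect_le_iff.2 ⟨(le_top : _ ≤ (⊤ : X)), h₁⟩)))

theorem hasAnchors_of_boundedOrder [Nonempty Y] : BoxProd.HasAnchors (PairFam X Y) where
  exists_fits P Q := by
    classical
    obtain ⟨y₀⟩ := ‹Nonempty Y›
    let S : Finset Y := insert y₀ (P.image (fun p => p.1 .right) ∪ Q.image fun q => q.1 .right)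
    have hS : S.Nonempty := Finset.insert_nonempty _ _
    refine ⟨anchor (S.inf' hS id), fun q hq => ?_, fun p hp => fits_anchor ?_⟩
    · exact mem_intent_pure.2 (rel_iff.2 (Or.inr (Finset.inf'_le id (Finset.mem_insert_of_mem
        (Finset.mem_union_right _ (Finset.mem_image_of_mem _ hq))))))
    · exact Finset.inf'_le id (Finset.mem_insert_of_mem
        (Finset.mem_union_left _ (Finset.mem_image_of_mem _ hp)))

end Bounded

end PairFam

/-! ### Tensor products of two semilattices -/

namespace SemilatticeTensor

section

variable {A B : Type u} [SemilatticeSup A] [OrderBot A] [SemilatticeSup B] [OrderBot B]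

open Classical in
/-- The pure tensor of two elements. -/
def tmul (a : A) (b : B) : SemilatticeTensor A B :=
  if h : a ≠ ⊥ ∧ b ≠ ⊥ then PresentedSemilattice.gen _ (⟨a, h.1⟩, ⟨b, h.2⟩) else ⊥

theorem tmul_of_ne (a : {a : A // a ≠ ⊥}) (b : {b : B // b ≠ ⊥}) :
    tmul a.1 b.1 = PresentedSemilattice.gen (Relations A B) (a, b) := dif_pos ⟨a.2, b.2⟩

@[simp] theorem bot_tmul (b : B) : tmul (⊥ : A) b = ⊥ := dif_neg fun h => h.1 rfl

@[simp] theorem tmul_bot (a : A) : tmul a (⊥ : B) = ⊥ := dif_neg fun h => h.2 rfl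

theorem sup_tmul (a a' : A) (b : B) : tmul (a ⊔ a') b = tmul a b ⊔ tmul a' b := by
  classical
  by_cases hb : b = ⊥
  · subst hb
    simp
  by_cases ha : a = ⊥
  · subst ha
    simp
  by_cases ha' : a' = ⊥
  · subst ha'
    simp
  have h := PresentedSemilattice.sup_gen_eq (Relations.left ⟨a, ha⟩ ⟨a', ha'⟩
    ⟨a ⊔ a', fun h => ha (sup_eq_bot_iff.1 h).1⟩ ⟨b, hb⟩ rfl)
  simp only [Finset.sup_insert, Finset.sup_singleton, ← tmul_of_ne] at h
  exact h.symm

theorem tmul_sup (a : A) (b b' : B) : tmul a (b ⊔ b') = tmul a b ⊔ tmul a b' := by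
  classical
  by_cases ha : a = ⊥
  · subst ha
    simp
  by_cases hb : b = ⊥
  · subst hb
    simp
  by_cases hb' : b' = ⊥
  · subst hb'
    simp
  have h := PresentedSemilattice.sup_gen_eq (Relations.right ⟨a, ha⟩ ⟨b, hb⟩ ⟨b', hb'⟩
    ⟨b ⊔ b', fun h => hb (sup_eq_bot_iff.1 h).1⟩ rfl)
  simp only [Finset.sup_insert, Finset.sup_singleton, ← tmul_of_ne] at h
  exact h.symm

theorem tmul_mono {a a' : A} {b b' : B} (ha : a ≤ a') (hb : b ≤ b') : tmul a b ≤ tmul a' b' := by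
  rw [← sup_eq_right.2 ha, ← sup_eq_right.2 hb, sup_tmul, tmul_sup, tmul_sup]
  exact le_sup_left.trans le_sup_left

end

variable {X Y A B : Type u} [Lattice X] [Lattice Y] [SemilatticeSup A] [OrderBot A]
  [SemilatticeSup B] [OrderBot B]

/-- A pair of congruences as a tuple. -/
def conPair (α : LatticeCon X) (β : LatticeCon Y) : ∀ i, LatticeCon (PairFam X Y i)
  | .left => α
  | .right => β

theorem isMultiIdeal (e : Conc X ≃o A) (f : Conc Y ≃o B) (v : SemilatticeTensor A B) :
    IsMultiIdeal {y : ∀ i, Conc (PairFam X Y i) | tmul (e (y .left)) (f (y .right)) ≤ v} where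
  lower {x y} hxy hy :=
    (tmul_mono (e.monotone (hxy Side.left)) (f.monotone (hxy Side.right))).trans hy
  bot {x i} hx := by
    cases i
    · have : e (x .left) = ⊥ := (congrArg e hx).trans e.map_bot
      change tmul (e (x .left)) _ ≤ v
      rw [this, bot_tmul]
      exact bot_le
    · have : f (x .right) = ⊥ := (congrArg f hx).trans f.map_bot
      change tmul _ (f (x .right)) ≤ v
      rw [this, tmul_bot]
      exact bot_le
  sup {x y z i} hz hne hx hy := by
    cases i
    · have h₁ : e (z .left) = e (x .left) ⊔ e (y .left) := (congrArg e hz).trans (e.map_sup _ _)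
      obtain ⟨h₂, h₃⟩ := hne .right (by simp)
      change tmul (e (x .left)) (f (x .right)) ≤ v at hx
      change tmul (e (y .left)) (f (y .right)) ≤ v at hy
      change tmul (e (z .left)) (f (z .right)) ≤ v
      rw [h₂] at hx
      rw [h₃] at hy
      rw [h₁, sup_tmul]
      exact sup_le hx hy
    · have h₁ : f (z .right) = f (x .right) ⊔ f (y .right) :=
        (congrArg f hz).trans (f.map_sup _ _)
      obtain ⟨h₂, h₃⟩ := hne .left (by simp)
      change tmul (e (x .left)) (f (x .right)) ≤ v at hx
      change tmul (e (y .left)) (f (y .right)) ≤ v at hy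
      change tmul (e (z .left)) (f (z .right)) ≤ v
      rw [h₂] at hx
      rw [h₃] at hy
      rw [h₁, tmul_sup]
      exact sup_le hx hy

/-- The tuple of congruences corresponding to a pure tensor. -/
def sides (e : Conc X ≃o A) (f : Conc Y ≃o B) (a : A) (b : B) :
    ∀ i, LatticeCon (PairFam X Y i) := conPair (e.symm a).1 (f.symm b).1

variable [BoxProd.HasAnchors (PairFam X Y)]

theorem tens_sides_sup_left (e : Conc X ≃o A) (f : Conc Y ≃o B) (a a' : A) (b : B) :
    BoxProd.tens (sides e f (a ⊔ a') b) =
      BoxProd.tens (sides e f a b) ⊔ BoxProd.tens (sides e f a' b) :=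
  BoxProd.tens_sup (i := Side.left) (congrArg Subtype.val (e.symm.map_sup a a')) fun j hj => by
    cases j
    · exact absurd rfl hj
    · exact ⟨rfl, rfl⟩

theorem tens_sides_sup_right (e : Conc X ≃o A) (f : Conc Y ≃o B) (a : A) (b b' : B) :
    BoxProd.tens (sides e f a (b ⊔ b')) =
      BoxProd.tens (sides e f a b) ⊔ BoxProd.tens (sides e f a b') :=
  BoxProd.tens_sup (i := Side.right) (congrArg Subtype.val (f.symm.map_sup b b')) fun j hj => by
    cases j
    · exact ⟨rfl, rfl⟩
    · exact absurd rfl hj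

/-- The homomorphism from the tensor product to the congruences of the box product. -/
def toCon (e : Conc X ≃o A) (f : Conc Y ≃o B) :
    SupBotHom (SemilatticeTensor A B) (LatticeCon (BoxProd (PairFam X Y))) :=
  PresentedSemilattice.lift (fun x => BoxProd.tens (sides e f x.1.1 x.2.1)) (by
    classical
    rintro _ _ (⟨a, b₀, b₁, b, h⟩ | ⟨a₀, a₁, a, b, h⟩)
    · rw [Finset.sup_insert, Finset.sup_singleton, Finset.sup_singleton, h,
        tens_sides_sup_right]
    · rw [Finset.sup_insert, Finset.sup_singleton, Finset.sup_singleton, h,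
        tens_sides_sup_left])

theorem toCon_tmul (e : Conc X ≃o A) (f : Conc Y ≃o B) (a : A) (b : B) :
    toCon e f (tmul a b) = BoxProd.tens (sides e f a b) := by
  by_cases ha : a = ⊥
  · subst ha
    rw [bot_tmul, map_bot]
    exact (BoxProd.tens_eq_bot (i := Side.left) (congrArg Subtype.val e.symm.map_bot)).symm
  by_cases hb : b = ⊥
  · subst hb
    rw [tmul_bot, map_bot]
    exact (BoxProd.tens_eq_bot (i := Side.right) (congrArg Subtype.val f.symm.map_bot)).symm
  rw [tmul_of_ne ⟨a, ha⟩ ⟨b, hb⟩]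
  exact PresentedSemilattice.lift_gen _ _ _

theorem nonempty_conc_boxProd_orderIso [Nonempty X] [Nonempty Y] (e : Conc X ≃o A)
    (f : Conc Y ≃o B) : Nonempty (Conc (BoxProd (PairFam X Y)) ≃o SemilatticeTensor A B) := by
  obtain ⟨x₀⟩ := ‹Nonempty X›
  obtain ⟨y₀⟩ := ‹Nonempty Y›
  refine BoxProd.nonempty_conc_orderIso (PresentedSemilattice.gen (Relations A B))
    (fun x => sides e f x.1.1 x.2.1) (toCon e f) (fun t => ?_) (fun x => ?_) (fun x i => ?_)
    (fun x => Set.toFinite _) (fun x v hv => ?_) (fun p q => ?_)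
    (PairFam.rect x₀ y₀) (PairFam.box x₀ y₀)
  · induction t using PresentedSemilattice.ind with
    | h s => exact ⟨s, PresentedSemilattice.mk_eq_sup_gen s⟩
  · exact PresentedSemilattice.lift_gen _ _ _
  · cases i
    · exact (e.symm x.1.1).2
    · exact (f.symm x.2.1).2
  · let y₁ : ∀ i, Conc (PairFam X Y i) := fun
      | .left => e.symm x.1.1
      | .right => f.symm x.2.1
    have hy₁ : ¬ tmul (e (e.symm x.1.1)) (f (f.symm x.2.1)) ≤ v := by
      rwa [e.apply_symm_apply, f.apply_symm_apply, tmul_of_ne]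
    obtain ⟨α, hα, hN⟩ := (isMultiIdeal e f v).exists_separation (x := y₁) hy₁
    induction v using PresentedSemilattice.ind with
    | h s =>
      refine ⟨α, s, fun i => ?_, PresentedSemilattice.mk_eq_sup_gen s, fun y hy => ?_⟩
      · have := hα i
        cases i <;> exact this
      · let y₂ : ∀ i, Conc (PairFam X Y i) := fun
          | .left => e.symm y.1.1
          | .right => f.symm y.2.1
        have hy₂ : tmul (e (e.symm y.1.1)) (f (f.symm y.2.1)) ≤
            PresentedSemilattice.mk (Relations A B) s := by
          rw [e.apply_symm_apply, f.apply_symm_apply, tmul_of_ne,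
            PresentedSemilattice.mk_eq_sup_gen]
          exact Finset.le_sup hy
        obtain ⟨i, hi⟩ := hN y₂ hy₂
        refine ⟨i, ?_⟩
        cases i <;> exact hi
  · let a : Conc X := ⟨BoxProd.excessTuple p q .left, LatticeCon.isCompactElement_excess _ _⟩
    let b : Conc Y := ⟨BoxProd.excessTuple p q .right, LatticeCon.isCompactElement_excess _ _⟩
    refine ⟨tmul (e a) (f b), (toCon_tmul e f _ _).trans (congrArg BoxProd.tens ?_)⟩
    funext i
    cases i
    · exact congrArg Subtype.val (e.symm_apply_apply a)
    · exact congrArg Subtype.val (f.symm_apply_apply b)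

end SemilatticeTensor

/-! ### Iterated tensor products -/

namespace SemilatticePiTensor

section

variable {ι : Type u} {S : ι → Type u} [∀ i, SemilatticeSup (S i)] [∀ i, OrderBot (S i)]

theorem sup_pair {G T : Type*} [SemilatticeSup T] [OrderBot T] {d : DecidableEq G} (f : G → T)
    (x y : G) : ({x, y} : Finset G).sup f = f x ⊔ f y := by
  rw [Finset.sup_insert, Finset.sup_singleton]

theorem tprod_eq_bot {x : ∀ i, S i} {i : ι} (h : x i = ⊥) : tprod S x = ⊥ :=
  Finset.sup_singleton.symm.trans (PresentedSemilattice.sup_gen_eq (Relations.zero x i h))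

theorem tprod_sup {x y z : ∀ i, S i} {i : ι} (h : z i = x i ⊔ y i)
    (hne : ∀ j, j ≠ i → x j = z j ∧ y j = z j) : tprod S z = tprod S x ⊔ tprod S y :=
  Finset.sup_singleton.symm.trans ((PresentedSemilattice.sup_gen_eq
    (Relations.sup x y z i h hne)).symm.trans (sup_pair _ _ _))

theorem tprod_mono [Finite ι] {x y : ∀ i, S i} (h : x ≤ y) : tprod S x ≤ tprod S y := by
  classical
  have := Fintype.ofFinite ι
  have key : ∀ s : Finset ι, tprod S x ≤ tprod S (s.piecewise y x) := by
    intro s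
    induction s using Finset.induction with
    | empty => simp
    | insert i s hi ih =>
      refine ih.trans (le_sup_left.trans (tprod_sup (i := i) (y := (insert i s).piecewise y x)
        ?_ fun j hj => ⟨?_, rfl⟩).ge)
      · rw [Finset.piecewise_eq_of_notMem _ _ _ hi, Finset.piecewise_insert_self,
          sup_eq_right.2 (h i)]
      · rw [Finset.piecewise_insert, Function.update_of_ne hj]
  simpa using key Finset.univ

end

end SemilatticePiTensor

namespace IteratedTensor

section Incl

variable {I : Type u} (S : I → Type u) [∀ i, SemilatticeSup (S i)] [∀ i, OrderBot (S i)]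
  [∀ i, OrderTop (S i)]

theorem incl_bot (J : Finset I) : incl S J ⊥ = ⊥ :=
  ((incl_transition S ∅ J (Finset.empty_subset J) ⊥).symm.trans
    (congrArg (incl S J) (map_bot (transition S ∅ J (Finset.empty_subset J))))).symm

/-- The canonical homomorphism of a finite tensor product into the iterated tensor product. -/
def inclHom (J : Finset I) : SupBotHom (Stage S J) (IteratedTensor S) where
  toFun := incl S J
  map_sup' := incl_sup S J
  map_bot' := incl_bot S J

variable {S}

/-- The image of a pure tensor in the iterated tensor product. -/
def pureTensor (x : Σ J : Finset I, ∀ i : J, S i) : IteratedTensor S :=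
  inclHom S x.1 (SemilatticePiTensor.tprod _ x.2)

theorem inclHom_mk (J : Finset I) (s : Finset (∀ i : J, S i)) :
    inclHom S J (PresentedSemilattice.mk _ s) = s.sup fun x => pureTensor ⟨J, x⟩ := by
  rw [PresentedSemilattice.mk_eq_sup_gen, map_finset_sup]
  rfl

theorem inclHom_transition {J K : Finset I} (h : J ≤ K) (a : Stage S J) :
    inclHom S K (transition S J K h a) = inclHom S J a := incl_transition S J K h a

theorem pureTensor_extend {J K : Finset I} (h : J ≤ K) (x : ∀ i : J, S i) :
    pureTensor ⟨K, extend S J K x⟩ = pureTensor ⟨J, x⟩ :=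
  (congrArg (inclHom S K) (transition_tprod S J K h x)).symm.trans (inclHom_transition h _)

theorem exists_eq_inclHom_mk (t : IteratedTensor S) :
    ∃ (J : Finset I) (s : Finset (∀ i : J, S i)),
      t = inclHom S J (PresentedSemilattice.mk _ s) := by
  obtain ⟨J, a, rfl⟩ := DirectLimit.exists_eq_mk (transition S) t
  induction a using PresentedSemilattice.ind with
  | h s => exact ⟨J, s, rfl⟩

end Incl

variable {I : Type u} {A S : I → Type u} [∀ i, Lattice (A i)] [∀ i, SemilatticeSup (S i)]
  [∀ i, OrderBot (S i)] [∀ i, OrderTop (S i)]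

theorem isMultiIdeal (e : ∀ i, Conc (A i) ≃o S i) (J : Finset I) (v : IteratedTensor S) :
    IsMultiIdeal {y : ∀ i : J, Conc (A i) | pureTensor ⟨J, fun i => e i (y i)⟩ ≤ v} where
  lower {x y} hxy hy :=
    (OrderHomClass.mono (inclHom S J)
      (SemilatticePiTensor.tprod_mono (S := fun i : J => S i) fun i => (e i).monotone (hxy i))).trans hy
  bot {x i} hx :=
    ((congrArg (inclHom S J) (SemilatticePiTensor.tprod_eq_bot (S := fun i : J => S i) (i := i)
      ((congrArg (e i) hx).trans (e i).map_bot))).trans (map_bot _)).le.trans bot_le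
  sup {x y z i} hz hne hx hy :=
    ((congrArg (inclHom S J) (SemilatticePiTensor.tprod_sup (S := fun i : J => S i)
      (x := fun i => e i (x i)) (y := fun i => e i (y i)) (i := i)
      ((congrArg (e i) hz).trans ((e i).map_sup _ _))
      fun j hj => ⟨congrArg (e j) (hne j hj).1, congrArg (e j) (hne j hj).2⟩)).trans
        (map_sup _ _ _)).le.trans (sup_le hx hy)

open Classical in
/-- The tuple of congruences corresponding to a pure tensor. -/
def coords (e : ∀ i, Conc (A i) ≃o S i) (x : Σ J : Finset I, ∀ i : J, S i) (i : I) :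
    LatticeCon (A i) :=
  if h : i ∈ x.1 then ((e i).symm (x.2 ⟨i, h⟩)).1 else ⊤

theorem coords_of_mem (e : ∀ i, Conc (A i) ≃o S i) {x : Σ J : Finset I, ∀ i : J, S i} {i : I}
    (h : i ∈ x.1) : coords e x i = ((e i).symm (x.2 ⟨i, h⟩)).1 := dif_pos h

theorem coords_of_notMem (e : ∀ i, Conc (A i) ≃o S i) {x : Σ J : Finset I, ∀ i : J, S i} {i : I}
    (h : i ∉ x.1) : coords e x i = ⊤ := dif_neg h

theorem finite_coords_ne_top (e : ∀ i, Conc (A i) ≃o S i) (x : Σ J : Finset I, ∀ i : J, S i) :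
    {i | coords e x i ≠ ⊤}.Finite :=
  x.1.finite_toSet.subset fun i hi => by
    by_contra h
    exact hi (coords_of_notMem e h)

variable [∀ i, BoundedOrder (A i)]

theorem isCompactElement_top (i : I) : IsCompactElement (⊤ : LatticeCon (A i)) :=
  LatticeCon.excess_eq_top (isTop_top : IsTop (⊤ : A i)) isBot_bot ▸
    LatticeCon.isCompactElement_excess _ _

theorem symm_top (e : ∀ i, Conc (A i) ≃o S i) (i : I) : ((e i).symm ⊤).1 = ⊤ :=
  top_le_iff.1 (show (⟨⊤, isCompactElement_top i⟩ : Conc (A i)) ≤ (e i).symm ⊤ from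
    (e i).le_symm_apply.2 le_top)

theorem isCompactElement_coords (e : ∀ i, Conc (A i) ≃o S i) (x : Σ J : Finset I, ∀ i : J, S i)
    (i : I) : IsCompactElement (coords e x i) := by
  by_cases h : i ∈ x.1
  · rw [coords_of_mem e h]
    exact ((e i).symm _).2
  · rw [coords_of_notMem e h]
    exact isCompactElement_top i

theorem coords_eq_extend (e : ∀ i, Conc (A i) ≃o S i) {J K : Finset I} (x : ∀ i : J, S i)
    (i : K) : coords e ⟨J, x⟩ i = ((e i).symm (extend S J K x i)).1 := by
  by_cases h : (i : I) ∈ J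
  · rw [extend_of_mem x i h]
    exact coords_of_mem e h
  · rw [extend_of_notMem x i h, symm_top]
    exact coords_of_notMem e h

theorem coords_extend (e : ∀ i, Conc (A i) ≃o S i) {J K : Finset I} (h : J ≤ K)
    (x : ∀ i : J, S i) : coords e ⟨K, extend S J K x⟩ = coords e ⟨J, x⟩ := by
  funext i
  by_cases hi : i ∈ K
  · exact (coords_of_mem e hi).trans (coords_eq_extend e x ⟨i, hi⟩).symm
  · exact (coords_of_notMem e hi).trans (coords_of_notMem e fun hJ => hi (h hJ)).symm

theorem coords_eq_bot (e : ∀ i, Conc (A i) ≃o S i) {J : Finset I} {x : ∀ i : J, S i} {i : J}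
    (h : x i = ⊥) : coords e ⟨J, x⟩ i = ⊥ :=
  (coords_of_mem e i.2).trans (congrArg Subtype.val
    ((congrArg (e i).symm h).trans (e i).symm.map_bot))

theorem coords_eq_sup (e : ∀ i, Conc (A i) ≃o S i) {J : Finset I} {x y z : ∀ i : J, S i} {i : J}
    (h : z i = x i ⊔ y i) : coords e ⟨J, z⟩ i = coords e ⟨J, x⟩ i ⊔ coords e ⟨J, y⟩ i := by
  rw [coords_of_mem e i.2, coords_of_mem e i.2, coords_of_mem e i.2]
  exact congrArg Subtype.val ((congrArg (e i).symm h).trans ((e i).symm.map_sup _ _))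

theorem coords_congr (e : ∀ i, Conc (A i) ≃o S i) {J : Finset I} {x y : ∀ i : J, S i} {i : I}
    (h : ∀ h : i ∈ J, x ⟨i, h⟩ = y ⟨i, h⟩) : coords e ⟨J, x⟩ i = coords e ⟨J, y⟩ i := by
  by_cases hi : i ∈ J
  · rw [coords_of_mem e hi, coords_of_mem e hi]
    exact congrArg (fun c => ((e i).symm c).1) (h hi)
  · rw [coords_of_notMem e hi, coords_of_notMem e hi]

/-- The homomorphism from a finite tensor product to the congruences of the box product. -/
def stageCon (e : ∀ i, Conc (A i) ≃o S i) (J : Finset I) :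
    SupBotHom (Stage S J) (LatticeCon (BoxProd A)) :=
  PresentedSemilattice.lift (fun x => BoxProd.tens (coords e ⟨J, x⟩)) (by
    rintro _ _ (⟨x, i, hx⟩ | ⟨x, y, z, i, hz, hne⟩)
    · rw [Finset.sup_singleton, Finset.sup_empty]
      exact BoxProd.tens_eq_bot (coords_eq_bot e hx)
    · rw [SemilatticePiTensor.sup_pair, Finset.sup_singleton]
      refine (BoxProd.tens_sup (coords_eq_sup e hz) fun j hj =>
        ⟨coords_congr e fun h => ?_, coords_congr e fun h => ?_⟩).symm
      · exact (hne ⟨j, h⟩ fun h' => hj (congrArg Subtype.val h')).1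
      · exact (hne ⟨j, h⟩ fun h' => hj (congrArg Subtype.val h')).2)

theorem stageCon_tprod (e : ∀ i, Conc (A i) ≃o S i) {J : Finset I} (x : ∀ i : J, S i) :
    stageCon e J (SemilatticePiTensor.tprod _ x) = BoxProd.tens (coords e ⟨J, x⟩) :=
  PresentedSemilattice.lift_gen _ _ _

theorem stageCon_transition (e : ∀ i, Conc (A i) ≃o S i) {J K : Finset I} (h : J ≤ K)
    (a : Stage S J) : stageCon e K (transition S J K h a) = stageCon e J a := by
  have : (stageCon e K).comp (transition S J K h) = stageCon e J :=
    PresentedSemilattice.hom_ext fun x => by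
      refine (congrArg (stageCon e K) (transition_tprod S J K h x)).trans
        ((stageCon_tprod e _).trans (Eq.trans ?_ (stageCon_tprod e x).symm))
      rw [coords_extend e h]
  exact DFunLike.congr_fun this a

/-- The homomorphism from the iterated tensor product to the congruences of the box product. -/
def toCon (e : ∀ i, Conc (A i) ≃o S i) :
    SupBotHom (IteratedTensor S) (LatticeCon (BoxProd A)) where
  toFun := DirectLimit.lift (transition S) (fun J a => stageCon e J a)
    fun _ _ h a => (stageCon_transition e h a).symm
  map_sup' a b := by
    obtain ⟨J, x, y, rfl, rfl⟩ := DirectLimit.exists_eq_mk₂ (transition S) a b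
    exact (congrArg _ (incl_sup S J x y).symm).trans (map_sup (stageCon e J) x y)
  map_bot' := map_bot (stageCon e ∅)

theorem toCon_pureTensor (e : ∀ i, Conc (A i) ≃o S i) (x : Σ J : Finset I, ∀ i : J, S i) :
    toCon e (pureTensor x) = BoxProd.tens (coords e x) :=
  stageCon_tprod e x.2

theorem pureTensor_eq_bot_of_top_eq_bot {x : Σ J : Finset I, ∀ i : J, S i} {i : I} (hi : i ∉ x.1)
    (h : (⊤ : S i) = ⊥) : pureTensor x = ⊥ := by
  classical
  obtain ⟨J, x⟩ := x
  rw [← pureTensor_extend (Finset.subset_insert i J) x]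
  have hi' : i ∈ insert i J := Finset.mem_insert_self i J
  exact (congrArg (inclHom S _) (SemilatticePiTensor.tprod_eq_bot
    ((extend_of_notMem x (⟨i, hi'⟩ : (insert i J : Finset I)) hi).trans h))).trans (map_bot _)

theorem exists_separation (e : ∀ i, Conc (A i) ≃o S i) (x : Σ J : Finset I, ∀ i : J, S i)
    (v : IteratedTensor S) (hv : ¬ pureTensor x ≤ v) :
    ∃ (α : ∀ i, LatticeCon (A i)) (F : Finset (Σ J : Finset I, ∀ i : J, S i)),
      (∀ i, ¬ coords e x i ≤ α i) ∧ v = F.sup pureTensor ∧ ∀ y ∈ F, ∃ i, coords e y i ≤ α i := by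
  classical
  obtain ⟨J, x⟩ := x
  obtain ⟨K, s, hJK, hvs⟩ : ∃ (K : Finset I) (s : Finset (∀ i : K, S i)),
      J ≤ K ∧ v = s.sup fun y => pureTensor ⟨K, y⟩ := by
    obtain ⟨M, a, rfl⟩ := DirectLimit.exists_eq_mk (transition S) v
    have h := inclHom_transition (S := S) (Finset.subset_union_right : M ⊆ J ∪ M) a
    generalize transition S M (J ∪ M) Finset.subset_union_right a = b at h
    induction b using PresentedSemilattice.ind with
    | h s => exact ⟨J ∪ M, s, Finset.subset_union_left, h.symm.trans (inclHom_mk _ s)⟩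
  have hx : ¬ pureTensor ⟨K, fun i : K => e i ((e i).symm (extend S J K x i))⟩ ≤ v := by
    simpa only [OrderIso.apply_symm_apply, pureTensor_extend hJK] using hv
  obtain ⟨α, hα, hN⟩ := (isMultiIdeal e K v).exists_separation
    (x := fun i : K => (e i).symm (extend S J K x i)) hx
  refine ⟨fun i => if h : i ∈ K then α ⟨i, h⟩ else ⊥, s.image (Sigma.mk K), fun i hi => ?_, ?_,
    fun y hy => ?_⟩
  · by_cases h : i ∈ K
    · beta_reduce at hi
      rw [dif_pos h, coords_eq_extend e x ⟨i, h⟩] at hi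
      exact hα _ hi
    · have hJ : i ∉ J := fun hJ => h (hJK hJ)
      beta_reduce at hi
      rw [dif_neg h, coords_of_notMem e hJ, le_bot_iff] at hi
      refine hv ((pureTensor_eq_bot_of_top_eq_bot hJ ?_).le.trans bot_le)
      have : (e i).symm ⊤ = ⊥ := Subtype.ext ((symm_top e i).trans hi)
      rw [← (e i).apply_symm_apply ⊤, this, OrderIso.map_bot]
  · rw [hvs, Finset.sup_image]
    rfl
  · obtain ⟨y, hys, rfl⟩ := Finset.mem_image.1 hy
    obtain ⟨i, hi⟩ := hN (fun i : K => (e i).symm (y i)) (by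
      simp only [Set.mem_ofPred_eq, OrderIso.apply_symm_apply]
      rw [hvs]
      exact Finset.le_sup (f := fun y => pureTensor ⟨K, y⟩) hys)
    refine ⟨i, ?_⟩
    beta_reduce
    rw [dif_pos i.2, coords_of_mem e i.2]
    exact hi

theorem nonempty_conc_boxProd_orderIso (e : ∀ i, Conc (A i) ≃o S i) :
    Nonempty (Conc (BoxProd A) ≃o IteratedTensor S) := by
  classical
  refine BoxProd.nonempty_conc_orderIso pureTensor (coords e) (toCon e) (fun t => ?_)
    (toCon_pureTensor e) (isCompactElement_coords e) (finite_coords_ne_top e)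
    (exists_separation e) (fun p q => ?_) (BoxProd.topRect A) (BoxProd.botBox A)
  · obtain ⟨J, s, rfl⟩ := exists_eq_inclHom_mk t
    exact ⟨s.image (Sigma.mk J), by rw [inclHom_mk, Finset.sup_image]; rfl⟩
  · let J : Finset I := (BoxProd.finite_excessTuple_ne_top p q).toFinset
    refine ⟨pureTensor ⟨J, fun i => e i ⟨BoxProd.excessTuple p q i,
      LatticeCon.isCompactElement_excess _ _⟩⟩, (toCon_pureTensor e _).trans
        (congrArg BoxProd.tens (funext fun i => ?_))⟩
    by_cases h : i ∈ J
    · exact (coords_of_mem e h).trans (congrArg Subtype.val ((e i).symm_apply_apply _))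
    · refine (coords_of_notMem e h).trans ?_
      simpa [J, eq_comm] using h

end IteratedTensor

theorem PairFam.nonempty_boxProd {X Y : Type u} [Lattice X] [Lattice Y] [BoundedOrder X]
    [Nonempty Y] : Nonempty (BoxProd (PairFam X Y)) :=
  ⟨PairFam.anchor (Classical.arbitrary Y)⟩

theorem PairFam.hasPermutableCongruences {X Y : Type u} [Lattice X] [Lattice Y]
    (hX : HasPermutableCongruences X) (hY : HasPermutableCongruences Y) :
    ∀ i, HasPermutableCongruences (PairFam X Y i)
  | .left => hX
  | .right => hY

end

theorem mainTheorem12 :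
    -- `R₀` and `R₀,₁` are closed under tensor product
    (∀ (A B : Type u) [SemilatticeSup A] [OrderBot A] [SemilatticeSup B] [OrderBot B],
      IsZeroRepresentable A → IsZeroRepresentable B →
        IsZeroRepresentable (SemilatticeTensor A B)) ∧
    (∀ (A B : Type u) [SemilatticeSup A] [OrderBot A] [SemilatticeSup B] [OrderBot B],
      IsZeroOneRepresentable A → IsZeroOneRepresentable B →
        IsZeroOneRepresentable (SemilatticeTensor A B)) ∧
    -- if `A ∈ R₀,₁` and `B ∈ R`, then `A ⊗ B ∈ R`
    (∀ (A B : Type u) [SemilatticeSup A] [OrderBot A] [SemilatticeSup B] [OrderBot B],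
      IsZeroOneRepresentable A → IsRepresentable B →
        IsRepresentable (SemilatticeTensor A B)) ∧
    -- `R₀,₁` is closed under iterated tensor products
    (∀ (I : Type u) (S : I → Type u) [∀ i, SemilatticeSup (S i)] [∀ i, OrderBot (S i)]
      [∀ i, OrderTop (S i)],
      (∀ i, IsZeroOneRepresentable (S i)) → IsZeroOneRepresentable (IteratedTensor S)) ∧
    -- the same with permutable congruences
    (∀ (A B : Type u) [SemilatticeSup A] [OrderBot A] [SemilatticeSup B] [OrderBot B],
      IsPermZeroRepresentable A → IsPermZeroRepresentable B →
        IsPermZeroRepresentable (SemilatticeTensor A B)) ∧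
    (∀ (A B : Type u) [SemilatticeSup A] [OrderBot A] [SemilatticeSup B] [OrderBot B],
      IsPermZeroOneRepresentable A → IsPermZeroOneRepresentable B →
        IsPermZeroOneRepresentable (SemilatticeTensor A B)) ∧
    (∀ (A B : Type u) [SemilatticeSup A] [OrderBot A] [SemilatticeSup B] [OrderBot B],
      IsPermZeroOneRepresentable A → IsPermRepresentable B →
        IsPermRepresentable (SemilatticeTensor A B)) ∧
    (∀ (I : Type u) (S : I → Type u) [∀ i, SemilatticeSup (S i)] [∀ i, OrderBot (S i)]
      [∀ i, OrderTop (S i)],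
      (∀ i, IsPermZeroOneRepresentable (S i)) →
        IsPermZeroOneRepresentable (IteratedTensor S)) := by
  refine ⟨?_, ?_, ?_, ?_, ?_, ?_, ?_, ?_⟩
  · rintro A B _ _ _ _ ⟨X, _, _, ⟨e⟩⟩ ⟨Y, _, _, ⟨f⟩⟩
    exact ⟨_, inferInstance, inferInstance, SemilatticeTensor.nonempty_conc_boxProd_orderIso e f⟩
  · rintro A B _ _ _ _ ⟨X, _, _, ⟨e⟩⟩ ⟨Y, _, _, ⟨f⟩⟩
    exact ⟨_, inferInstance, inferInstance, SemilatticeTensor.nonempty_conc_boxProd_orderIso e f⟩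
  · rintro A B _ _ _ _ ⟨X, _, _, ⟨e⟩⟩ ⟨Y, _, _, ⟨f⟩⟩
    have := PairFam.hasAnchors_of_boundedOrder (X := X) (Y := Y)
    exact ⟨_, inferInstance, PairFam.nonempty_boxProd,
      SemilatticeTensor.nonempty_conc_boxProd_orderIso e f⟩
  · intro I S _ _ _ h
    choose A _ _ e using h
    exact ⟨_, inferInstance, inferInstance,
      IteratedTensor.nonempty_conc_boxProd_orderIso fun i => (e i).some⟩
  · rintro A B _ _ _ _ ⟨X, _, _, hX, ⟨e⟩⟩ ⟨Y, _, _, hY, ⟨f⟩⟩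
    exact ⟨_, inferInstance, inferInstance,
      BoxProd.hasPermutableCongruences (PairFam.hasPermutableCongruences hX hY),
      SemilatticeTensor.nonempty_conc_boxProd_orderIso e f⟩
  · rintro A B _ _ _ _ ⟨X, _, _, hX, ⟨e⟩⟩ ⟨Y, _, _, hY, ⟨f⟩⟩
    exact ⟨_, inferInstance, inferInstance,
      BoxProd.hasPermutableCongruences (PairFam.hasPermutableCongruences hX hY),
      SemilatticeTensor.nonempty_conc_boxProd_orderIso e f⟩
  · rintro A B _ _ _ _ ⟨X, _, _, hX, ⟨e⟩⟩ ⟨Y, _, _, hY, ⟨f⟩⟩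
    have := PairFam.hasAnchors_of_boundedOrder (X := X) (Y := Y)
    exact ⟨_, inferInstance, PairFam.nonempty_boxProd,
      BoxProd.hasPermutableCongruences (PairFam.hasPermutableCongruences hX hY),
      SemilatticeTensor.nonempty_conc_boxProd_orderIso e f⟩
  · intro I S _ _ _ h
    choose A _ _ hA e using h
    exact ⟨_, inferInstance, inferInstance, BoxProd.hasPermutableCongruences hA,
      IteratedTensor.nonempty_conc_boxProd_orderIso fun i => (e i).some⟩
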